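/- Let $M$ be a complete (smooth, boundaryless) Riemannian manifold of dimension $n+p$ with Levi-Civita connection $\nabla$ and curvature $R(X,Y,Z,W)=\langle\nabla_X\nabla_YZ-\nabla_Y\nabla_XZ-\nabla_{[X,Y]}Z,\,W\rangle$. Let $\mathcal F$ and $\mathcal F^\perp$ be smooth foliations of $M$ with leaves of dimension $n$ and $p$ respectively, such that $T_x\mathcal F^\perp$ is the orthogonal complement of $T_x\mathcal F$ for every $x\in M$. For orthonormal bases $(e_i)_{i\le n}$ of $T_x\mathcal F$ and $(e_\alpha)_{\alpha\le p}$ of $T_x\mathcal F^\perp$ (extended to local fields tangent to $\mathcal F$, $\mathcal F^\perp$ respectively) let $$h=\frac1n\sum_i(\nabla_{e_i}e_i)^\perp,\qquad h^\perp=\frac1p\sum_\alpha(\nabla_{e_\alpha}e_\alpha)^\top$$ be the normalized mean curvature vectors of the leaves of $\mathcal F$ and of $\mathcal F^\perp$, where $\perp$ and $\top$ denote the components tangent to $\mathcal F^\perp$ and $\mathcal F$ (and $h=0$ if $n=0$); let $\operatorname{div}_{\mathcal F}(X)=\sum_i\langle e_i,\nabla_{e_i}X\rangle$, and for a unit vector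 $v\in T_x\mathcal F^\perp$ let $\operatorname{Tr}(K^v)=\sum_iR(v,e_i,e_i,v)$. Suppose that 1. either $p\ge2$ and $\mathcal F^\perp$ is totally umbilical, i.e. for every $x\in M$ and $\xi\in T_x\mathcal F$ the Weingarten operator $u\mapsto-(\nabla_u\xi)^\perp$ of $T_x\mathcal F^\perp$ is a multiple of the identity, or $p=1$ (then the leaves of $\mathcal F^\perp$ are arbitrary curves, for instance round circles); 2. $\|h^\perp\|$ is bounded on $M$, and $L^\perp$ is a leaf of $\mathcal F^\perp$ such that $\|h^\perp\|$ attains its maximum over $M$ at some point of $L^\perp$; 3. $\operatorname{Tr}(K^v)\ge0$ for all $x\in M$ and all unit vectors $v\in T_x\mathcal F^\perp$; 4. $\operatorname{div}_{\mathcal F}(h^\perp)(x)\le\operatorname{Tr}(K^v)$ for all $x\in L^\perp$ and all unit vectors $v\in T_x\mathcal F^\perp$. Then $h=0$ along $L^\perp$. Moreover $h^\perp=0$ on all of $M$, $\operatorname{Tr}(K^v)=0$ for all $x\in M$ and all unit vectors $v\in T_x\mathcal F^\perp$, and $h=0$ on all of $M$. -/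

import Mathlib

open Bundle VectorField
open scoped Manifold
open scoped ContDiff Topology

noncomputable section

namespace FoliatedManifold

section LeviCivita

variable {E : Type*} [NormedAddCommGroup E] [NormedSpace ℝ E]
  {H : Type*} [TopologicalSpace H] {I : ModelWithCorners ℝ E H}
  {M : Type*} [TopologicalSpace M] [ChartedSpace H M]
  [RiemannianBundle (fun x : M ↦ TangentSpace I x)]

/-- The metric pairing of two vector fields, as a function on `M`. -/
def pairing (X Y : Π x : M, TangentSpace I x) (x : M) : ℝ := inner ℝ (X x) (Y x)

/-- Half of the right-hand side of the Koszul formula for `⟨∇_X Y, Z⟩` at `x`. -/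
def koszul (Y X Z : Π x : M, TangentSpace I x) (x : M) : ℝ :=
  (1 / 2) * (d% (pairing Y Z) x (X x) + d% (pairing X Z) x (Y x) - d% (pairing X Y) x (Z x)
    + inner ℝ (mlieBracket I X Y x) (Z x) - inner ℝ (mlieBracket I X Z x) (Y x)
    - inner ℝ (mlieBracket I Y Z x) (X x))

theorem pairing_comm (X Y : Π x : M, TangentSpace I x) : pairing X Y = pairing Y X := by
  ext x; exact real_inner_comm _ _

theorem pairing_add_left (X X' Y : Π x : M, TangentSpace I x) :
    pairing (X + X') Y = pairing X Y + pairing X' Y := by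
  ext x; exact inner_add_left _ _ _

theorem pairing_smul_left (f : M → ℝ) (X Y : Π x : M, TangentSpace I x) :
    pairing (f • X) Y = f * pairing X Y := by
  ext x; exact real_inner_smul_left _ _ _

theorem pairing_add_right (X Y Y' : Π x : M, TangentSpace I x) :
    pairing X (Y + Y') = pairing X Y + pairing X Y' := by
  ext x; exact inner_add_right _ _ _

theorem pairing_smul_right (f : M → ℝ) (X Y : Π x : M, TangentSpace I x) :
    pairing X (f • Y) = f * pairing X Y := by
  ext x; exact real_inner_smul_right _ _ _

variable [IsManifold I ∞ M]

theorem tangentEnd_ext {x : M} {A B : TangentSpace I x →L[ℝ] TangentSpace I x}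
    (h : ∀ X Z : Π x : M, TangentSpace I x, MDiffAt (T% X) x → MDiffAt (T% Z) x →
      inner ℝ (A (X x)) (Z x) = inner ℝ (B (X x)) (Z x)) : A = B := by
  ext v
  refine ext_inner_right ℝ fun w ↦ ?_
  simpa using h (FiberBundle.extend E v) (FiberBundle.extend E w)
    (FiberBundle.mdifferentiableAt_extend I E v) (FiberBundle.mdifferentiableAt_extend I E w)

variable [IsContMDiffRiemannianBundle I ∞ E (fun x : M ↦ TangentSpace I x)]

theorem mdifferentiableAt_pairing {X Y : Π x : M, TangentSpace I x} {x : M}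
    (hX : MDiffAt (T% X) x) (hY : MDiffAt (T% Y) x) : MDiffAt (pairing X Y) x :=
  MDifferentiableAt.inner_bundle (E := fun x : M ↦ TangentSpace I x) hX hY

variable [FiniteDimensional ℝ E]

theorem koszul_tensorial_left {Y Z : Π x : M, TangentSpace I x} {x : M}
    (hY : MDiffAt (T% Y) x) (hZ : MDiffAt (T% Z) x) :
    TensorialAt I E (fun X ↦ koszul (I := I) Y X Z x) x where
  smul {f X} hf hX := by
    simp only [koszul, pairing_smul_left, mvfderiv_mul hf (mdifferentiableAt_pairing hX hY),
      mvfderiv_mul hf (mdifferentiableAt_pairing hX hZ), mlieBracket_smul_left hf hX]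
    simp [inner_add_left, real_inner_smul_left, real_inner_smul_right, pairing]
    ring
  add {X X'} hX hX' := by
    simp only [koszul, pairing_add_left, 
      mvfderiv_add (mdifferentiableAt_pairing hX hY) (mdifferentiableAt_pairing hX' hY),
      mvfderiv_add (mdifferentiableAt_pairing hX hZ) (mdifferentiableAt_pairing hX' hZ),
       mlieBracket_add_left hX hX']
    simp [inner_add_left, inner_add_right]
    ring

theorem koszul_tensorial_right {Y X : Π x : M, TangentSpace I x} {x : M}
    (hY : MDiffAt (T% Y) x) (hX : MDiffAt (T% X) x) :
    TensorialAt I E (fun Z ↦ koszul (I := I) Y X Z x) x where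
  smul {f Z} hf hZ := by
    simp only [koszul, pairing_smul_right, mvfderiv_mul hf (mdifferentiableAt_pairing hX hZ),
      mvfderiv_mul hf (mdifferentiableAt_pairing hY hZ), mlieBracket_smul_right hf hZ]
    simp [inner_add_left, real_inner_smul_left, real_inner_smul_right, pairing,
      real_inner_comm (Y x) (Z x), real_inner_comm (X x) (Z x)]
    ring
  add {Z Z'} hZ hZ' := by
    simp only [koszul, pairing_add_right,
      mvfderiv_add (mdifferentiableAt_pairing hX hZ) (mdifferentiableAt_pairing hX hZ'),
      mvfderiv_add (mdifferentiableAt_pairing hY hZ) (mdifferentiableAt_pairing hY hZ'),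
       mlieBracket_add_right hZ hZ']
    simp [inner_add_left, inner_add_right]
    ring

theorem koszul_add {Y Y' X Z : Π x : M, TangentSpace I x} {x : M}
    (hY : MDiffAt (T% Y) x) (hY' : MDiffAt (T% Y') x) (hX : MDiffAt (T% X) x)
    (hZ : MDiffAt (T% Z) x) :
    koszul (I := I) (Y + Y') X Z x = koszul Y X Z x + koszul Y' X Z x := by
  simp only [koszul, pairing_add_left, pairing_add_right,
    mvfderiv_add (mdifferentiableAt_pairing hX hY) (mdifferentiableAt_pairing hX hY'),
    mvfderiv_add (mdifferentiableAt_pairing hY hZ) (mdifferentiableAt_pairing hY' hZ),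
    mlieBracket_add_right hY hY', mlieBracket_add_left hY hY']
  simp [inner_add_left, inner_add_right]
  ring

theorem koszul_leibniz {f : M → ℝ} {Y X Z : Π x : M, TangentSpace I x} {x : M}
    (hf : MDiffAt f x) (hY : MDiffAt (T% Y) x) (hX : MDiffAt (T% X) x)
    (hZ : MDiffAt (T% Z) x) :
    koszul (I := I) (f • Y) X Z x
      = f x * koszul Y X Z x + d% f x (X x) * inner ℝ (Y x) (Z x) := by
  simp only [koszul, pairing_smul_left, pairing_smul_right,
    mvfderiv_mul hf (mdifferentiableAt_pairing hX hY),
    mvfderiv_mul hf (mdifferentiableAt_pairing hY hZ),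
    mlieBracket_smul_right hf hY, mlieBracket_smul_left hf hY]
  simp [inner_add_left, real_inner_smul_left, real_inner_smul_right, pairing,
    real_inner_comm (X x) (Y x)]
  ring

instance finiteDimensional_tangentSpace (x : M) : FiniteDimensional ℝ (TangentSpace I x) :=
  inferInstanceAs (FiniteDimensional ℝ E)

instance completeSpace_tangentSpace (x : M) : CompleteSpace (TangentSpace I x) := FiniteDimensional.complete ℝ _

open Classical in
/-- `X ↦ ∇_X Y` at `x`, for a field `Y` differentiable at `x` (and `0` otherwise): the value is the
vector representing the linear form `Z ↦ koszul Y X Z x`. -/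
def leviCivitaFun (Y : Π x : M, TangentSpace I x) (x : M) :
    TangentSpace I x →L[ℝ] TangentSpace I x :=
  if hY : MDiffAt (T% Y) x then
    LinearMap.toContinuousLinearMap
      { toFun v := (InnerProductSpace.toDual ℝ (TangentSpace I x)).symm
          (TensorialAt.mkHom₂ (I := I) (F := E) (F' := E) (fun X Z ↦ koszul (I := I) Y X Z x) x
            (fun _ hZ ↦ koszul_tensorial_left hY hZ) (fun _ hX ↦ koszul_tensorial_right hY hX) v)
        map_add' v w := by simp
        map_smul' c v := by simp }
  else 0

theorem inner_leviCivitaFun {Y X Z : Π x : M, TangentSpace I x} {x : M}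
    (hY : MDiffAt (T% Y) x) (hX : MDiffAt (T% X) x) (hZ : MDiffAt (T% Z) x) :
    inner ℝ (leviCivitaFun Y x (X x)) (Z x) = koszul (I := I) Y X Z x := by
  rw [← TensorialAt.mkHom₂_apply (I := I) (F := E) (F' := E)
    (Φ := fun X Z ↦ koszul (I := I) Y X Z x)
    (fun _ hZ ↦ koszul_tensorial_left hY hZ) (fun _ hX ↦ koszul_tensorial_right hY hX) hX hZ]
  simp [leviCivitaFun, hY]

variable (I M) in
/-- The Levi-Civita connection of the Riemannian manifold `M`; `leviCivita I M Y x v` is `∇_v Y`. -/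
def leviCivita : CovariantDerivative I E (TangentSpace I : M → Type _) where
  toFun := leviCivitaFun
  isCovariantDerivativeOnUniv :=
    { add := by
        intro Y Y' x hY hY' _
        refine tangentEnd_ext fun X Z hX hZ ↦ ?_
        simp only [add_apply, inner_add_left, inner_leviCivitaFun hY hX hZ,
          inner_leviCivitaFun hY' hX hZ,
          inner_leviCivitaFun (mdifferentiableAt_add_section hY hY') hX hZ,
          koszul_add hY hY' hX hZ]
      leibniz := by
        intro Y f x hY hf _
        refine tangentEnd_ext fun X Z hX hZ ↦ ?_
        rw [inner_leviCivitaFun (hf.smul_section hY) hX hZ, koszul_leibniz hf hY hX hZ,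
          ← inner_leviCivitaFun hY hX hZ]
        simp [inner_add_left, real_inner_smul_left] }

theorem inner_leviCivita {Y X Z : Π x : M, TangentSpace I x} {x : M}
    (hY : MDiffAt (T% Y) x) (hX : MDiffAt (T% X) x) (hZ : MDiffAt (T% Z) x) :
    inner ℝ (leviCivita I M Y x (X x)) (Z x) = koszul (I := I) Y X Z x :=
  inner_leviCivitaFun hY hX hZ

theorem leviCivita_metric {X Y Z : Π x : M, TangentSpace I x} {x : M}
    (hX : MDiffAt (T% X) x) (hY : MDiffAt (T% Y) x) (hZ : MDiffAt (T% Z) x) :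
    d% (fun y ↦ inner ℝ (Y y) (Z y)) x (X x)
      = inner ℝ (leviCivita I M Y x (X x)) (Z x) + inner ℝ (Y x) (leviCivita I M Z x (X x)) := by
  rw [inner_leviCivita hY hX hZ, real_inner_comm, inner_leviCivita hZ hX hY]
  rw [koszul, koszul, pairing_comm Z Y, mlieBracket_swap_apply (V := Z) (W := Y)]
  simp only [inner_neg_left]
  change d% (pairing Y Z) x (X x) = _
  ring

theorem leviCivita_torsion : (leviCivita I M).torsion = 0 := by
  rw [CovariantDerivative.torsion_eq_zero_iff]
  intro X Y x hX hY
  refine ext_inner_right ℝ fun w ↦ ?_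
  have hZ := FiberBundle.mdifferentiableAt_extend I E w
  have e : w = FiberBundle.extend E w x := by simp
  rw [e, inner_sub_left, inner_leviCivita hY hX hZ, inner_leviCivita hX hY hZ, koszul, koszul,
    pairing_comm Y X, mlieBracket_swap_apply (V := Y) (W := X)]
  simp only [inner_neg_left]
  ring

end LeviCivita

section Curvature

variable {E : Type*} [NormedAddCommGroup E] [NormedSpace ℝ E] [FiniteDimensional ℝ E]
  {H : Type*} [TopologicalSpace H] (I : ModelWithCorners ℝ E H)
  {M : Type*} [TopologicalSpace M] [ChartedSpace H M] [IsManifold I ∞ M]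
  [RiemannianBundle (fun x : M ↦ TangentSpace I x)]
  [IsContMDiffRiemannianBundle I ∞ E (fun x : M ↦ TangentSpace I x)]

/-- `∇_X Y` as a vector field. -/
def nabla (X Y : Π x : M, TangentSpace I x) (x : M) : TangentSpace I x :=
  leviCivita I M Y x (X x)

/-- `R(X, Y)Z = ∇_X ∇_Y Z - ∇_Y ∇_X Z - ∇_[X,Y] Z` for vector fields. -/
def curvatureField (X Y Z : Π x : M, TangentSpace I x) (x : M) : TangentSpace I x :=
  nabla I X (nabla I Y Z) x - nabla I Y (nabla I X Z) x - nabla I (mlieBracket I X Y) Z x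

/-- The curvature tensor `R(u, v, w, z) = ⟨R(u, v)w, z⟩` of tangent vectors at `x`, computed with
extensions of the vectors to fields that are smooth near `x` (the value does not depend on them).
With this sign `R(u, v, v, u)` is the sectional curvature for orthonormal `u, v`. -/
def curvature (x : M) (u v w z : TangentSpace I x) : ℝ :=
  inner ℝ (curvatureField I (FiberBundle.extend E u) (FiberBundle.extend E v)
    (FiberBundle.extend E w) x) z

end Curvature

end FoliatedManifold

/-- A smooth foliation of `M` with `d`-dimensional leaves and codimension `c`, given by an atlas of
foliated charts: smooth charts onto products of two balls such that the changes of charts are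
locally of the form `(a, b) ↦ (h₁(a, b), h₂(b))`. -/
structure Foliation {E : Type*} [NormedAddCommGroup E] [NormedSpace ℝ E]
    {H : Type*} [TopologicalSpace H] (I : ModelWithCorners ℝ E H)
    (M : Type*) [TopologicalSpace M] [ChartedSpace H M] (d c : ℕ) where
  /-- The foliated charts. -/
  charts : Set (OpenPartialHomeomorph M (EuclideanSpace ℝ (Fin d) × EuclideanSpace ℝ (Fin c)))
  exists_mem_source : ∀ x : M, ∃ φ ∈ charts, x ∈ φ.source
  target_eq : ∀ φ ∈ charts, ∃ a r b s, φ.target = Metric.ball a r ×ˢ Metric.ball b s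
  contMDiffOn : ∀ φ ∈ charts, ContMDiffOn I
    𝓘(ℝ, EuclideanSpace ℝ (Fin d) × EuclideanSpace ℝ (Fin c)) ∞ φ φ.source
  contMDiffOn_symm : ∀ φ ∈ charts, ContMDiffOn
    𝓘(ℝ, EuclideanSpace ℝ (Fin d) × EuclideanSpace ℝ (Fin c)) I ∞ φ.symm φ.target
  compatible : ∀ φ ∈ charts, ∀ ψ ∈ charts, ∀ x ∈ φ.source ∩ ψ.source, ∃ U ∈ 𝓝 x,
    ∀ y ∈ U, ∀ z ∈ U, (φ y).2 = (φ z).2 → (ψ y).2 = (ψ z).2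

namespace Foliation

section Leaves

variable {E : Type*} [NormedAddCommGroup E] [NormedSpace ℝ E]
  {H : Type*} [TopologicalSpace H] {I : ModelWithCorners ℝ E H}
  {M : Type*} [TopologicalSpace M] [ChartedSpace H M] {d c : ℕ}

/-- Two points lie on a common plaque `{φ.2 = const}` of a foliated chart `φ`. -/
def SamePlaque (F : Foliation I M d c) (x y : M) : Prop :=
  ∃ φ ∈ F.charts, x ∈ φ.source ∧ y ∈ φ.source ∧ (φ x).2 = (φ y).2

/-- The leaf through `x`: the points that are joined to `x` by a finite chain of plaques. -/
def leaf (F : Foliation I M d c) (x : M) : Set M :=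
  {y | Relation.ReflTransGen F.SamePlaque x y}

/-- `L` is a leaf. -/
def IsLeaf (F : Foliation I M d c) (L : Set M) : Prop := ∃ x, L = F.leaf x

/-- The tangent space at `x` of the leaf through `x`: the vectors killed by the derivative of the
transverse coordinate `y ↦ (φ y).2` of the foliated charts `φ` around `x` (by compatibility, all
these charts give the same subspace). -/
def tangent (F : Foliation I M d c) (x : M) : Submodule ℝ (TangentSpace I x) :=
  ⨅ φ ∈ F.charts, ⨅ _ : x ∈ φ.source,
    (mfderiv I 𝓘(ℝ, EuclideanSpace ℝ (Fin c)) (fun y ↦ (φ y).2) x).ker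

end Leaves

section Geometry

open FoliatedManifold

variable {E : Type*} [NormedAddCommGroup E] [NormedSpace ℝ E] [FiniteDimensional ℝ E]
  {H : Type*} [TopologicalSpace H] {I : ModelWithCorners ℝ E H}
  {M : Type*} [TopologicalSpace M] [ChartedSpace H M]
  [IsManifold I ∞ M] [RiemannianBundle (fun x : M ↦ TangentSpace I x)] {d c : ℕ}

/-- Orthogonal foliations of complementary dimensions. -/
def IsOrthogonal (F : Foliation I M d c) (G : Foliation I M c d) : Prop :=
  ∀ x, G.tangent x = (F.tangent x)ᗮ

/-- The component of a vector tangent to the leaf. -/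
def tangentPart (F : Foliation I M d c) (x : M) (v : TangentSpace I x) : TangentSpace I x :=
  (F.tangent x).starProjection v

/-- The component of a vector orthogonal to the leaf. -/
def normalPart (F : Foliation I M d c) (x : M) (v : TangentSpace I x) : TangentSpace I x :=
  (F.tangent x)ᗮ.starProjection v

/-- A vector field, smooth near `x` and everywhere tangent to the leaves, with value `v` at `x` if
`v` is tangent to the leaf at `x`. -/
def tangentExtend (F : Foliation I M d c) {x : M} (v : TangentSpace I x) (y : M) :
    TangentSpace I y :=
  F.tangentPart y (FiberBundle.extend E v y)

/-- A vector field, smooth near `x` and everywhere orthogonal to the leaves, with value `v` at `x`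
if `v` is orthogonal to the leaf at `x`. -/
def normalExtend (F : Foliation I M d c) {x : M} (v : TangentSpace I x) (y : M) :
    TangentSpace I y :=
  F.normalPart y (FiberBundle.extend E v y)

/-- An orthonormal basis of the tangent space at `x` of the leaf through `x`. -/
def frame (F : Foliation I M d c) (x : M)
    (i : Fin (Module.finrank ℝ (F.tangent x))) : TangentSpace I x :=
  (stdOrthonormalBasis ℝ (F.tangent x) i : TangentSpace I x)

variable [IsContMDiffRiemannianBundle I ∞ E (fun x : M ↦ TangentSpace I x)]

/-- The Weingarten operator `A_ξ u = -(∇_u ξ)^tangent` of the leaf through `x`, for `ξ` normal and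
`u` tangent to the leaf at `x`. -/
def weingarten (F : Foliation I M d c) (x : M) (ξ u : TangentSpace I x) : TangentSpace I x :=
  -F.tangentPart x (leviCivita I M (F.normalExtend ξ) x u)

/-- All leaves are totally umbilical: every Weingarten operator is a multiple of the identity. -/
def IsTotallyUmbilical (F : Foliation I M d c) : Prop :=
  ∀ x, ∀ ξ ∈ (F.tangent x)ᗮ, ∃ μ : ℝ, ∀ u ∈ F.tangent x, F.weingarten x ξ u = μ • u

/-- The vector-valued second fundamental form `(∇_u v)^normal` of the leaf through `x`, for `u, v`
tangent to the leaf at `x`. -/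
def secondFundamentalForm (F : Foliation I M d c) (x : M) (u v : TangentSpace I x) :
    TangentSpace I x :=
  F.normalPart x (leviCivita I M (F.tangentExtend v) x u)

/-- The (normalized) mean curvature vector `(1/d) ∑ᵢ (∇_{eᵢ} eᵢ)^normal` of the leaves. -/
def meanCurvature (F : Foliation I M d c) (x : M) : TangentSpace I x :=
  (d : ℝ)⁻¹ • ∑ i, F.secondFundamentalForm x (F.frame x i) (F.frame x i)

/-- The divergence along the leaves, `div_F X = ∑ᵢ ⟨eᵢ, ∇_{eᵢ} X⟩`. -/
def divergence (F : Foliation I M d c) (X : Π x : M, TangentSpace I x) (x : M) : ℝ :=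
  ∑ i, inner ℝ (F.frame x i) (leviCivita I M X x (F.frame x i))

/-- The trace `∑ᵢ R(v, eᵢ, eᵢ, v)` over an orthonormal basis `eᵢ` of the tangent space of the
leaf. -/
def curvatureTrace (F : Foliation I M d c) (x : M) (v : TangentSpace I x) : ℝ :=
  ∑ i, curvature I x v (F.frame x i) (F.frame x i) v

end Geometry

end Foliation

end

noncomputable section

open FoliatedManifold Set Filter InnerProductSpace

set_option linter.unusedSectionVars false

namespace FoliatedManifold
section Calculus
variable {E : Type*} [NormedAddCommGroup E] [NormedSpace ℝ E]
  {H : Type*} [TopologicalSpace H] {I : ModelWithCorners ℝ E H}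
  {M : Type*} [TopologicalSpace M] [ChartedSpace H M]

theorem mvfderiv_congr {f g : M → ℝ} {x : M} (h : f =ᶠ[𝓝 x] g) : d% f x = d% g x := by
  ext v
  exact congrArg (fun L : TangentSpace I x →L[ℝ] ℝ ↦ L v) h.mfderiv_eq

variable [IsManifold I ∞ M]

theorem eventually_mdifferentiableAt {E' : Type*} [NormedAddCommGroup E'] [NormedSpace ℝ E']
    {H' : Type*} [TopologicalSpace H'] {J : ModelWithCorners ℝ E' H'}
    {N : Type*} [TopologicalSpace N] [ChartedSpace H' N] [IsManifold J ∞ N]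
    {f : M → N} {x : M} (hf : CMDiffAt ∞ f x) : ∀ᶠ y in 𝓝 x, MDiffAt f y := by
  have h : CMDiffAt 1 f x := hf.of_le (by simp)
  exact ((contMDiffAt_iff_contMDiffAt_nhds (by simp)).1 h).mono
    fun y hy ↦ hy.mdifferentiableAt (by simp)

theorem contMDiffAt_mvfderiv_apply {f : M → ℝ} {X : Π x : M, TangentSpace I x} {x : M}
    (hf : CMDiffAt ∞ f x) (hX : CMDiffAt ∞ (T% X) x) :
    CMDiffAt ∞ (fun y ↦ d% f y (X y)) x := by
  have h1 := hf.mfderiv_const (m := ∞) (by simp)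
  have h2 := ContMDiffAt.clm_apply_of_inCoordinates (F₁ := E) (F₂ := ℝ)
    (E₁ := TangentSpace I) (E₂ := TangentSpace 𝓘(ℝ, ℝ)) (b₁ := id) (b₂ := f)
    (v := X) h1 hX hf
  rw [contMDiffAt_totalSpace] at h2
  simp at h2
  exact h2.2

theorem contMDiffAt_field_congr {X Y : Π x : M, TangentSpace I x} {x : M}
    (hX : CMDiffAt ∞ (T% X) x) (h : ∀ᶠ y in 𝓝 x, X y = Y y) : CMDiffAt ∞ (T% Y) x :=
  hX.congr_of_eventuallyEq (h.mono fun y hy ↦ by simp [hy])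

variable (I M) in
theorem isManifold_minSmoothness_three : IsManifold I (minSmoothness ℝ 3) M := by
  rw [minSmoothness_of_isRCLikeNormedField]
  infer_instance

variable [FiniteDimensional ℝ E]

theorem mlieBracket_smul_right_eventuallyEq {f : M → ℝ} {Y Z : Π x : M, TangentSpace I x} {x : M}
    (hf : CMDiffAt ∞ f x) (hZ : CMDiffAt ∞ (T% Z) x) :
    mlieBracket I Y (f • Z) =ᶠ[𝓝 x]
      ((fun y ↦ d% f y (Y y)) • Z + f • mlieBracket I Y Z : Π x : M, TangentSpace I x) := by
  filter_upwards [eventually_mdifferentiableAt hf, eventually_mdifferentiableAt hZ] with y h1 h2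
  rw [mlieBracket_smul_right h1 h2]
  rfl

theorem contMDiffAt_mlieBracket {X Y : Π x : M, TangentSpace I x} {x : M}
    (hX : CMDiffAt ∞ (T% X) x) (hY : CMDiffAt ∞ (T% Y) x) :
    CMDiffAt ∞ (T% (mlieBracket I X Y)) x :=
  have : IsManifold I (((⊤ : ℕ∞) : ℕ∞ω) + 1) M := inferInstanceAs (IsManifold I ∞ M)
  have := isManifold_minSmoothness_three I M
  ContMDiffAt.mlieBracket_vectorField (m := ⊤) (n := ⊤) hX hY (by simp)

theorem mvfderiv_mlieBracket {f : M → ℝ} {X Y : Π x : M, TangentSpace I x} {x : M}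
    (hf : CMDiffAt ∞ f x) (hX : CMDiffAt ∞ (T% X) x) (hY : CMDiffAt ∞ (T% Y) x) :
    d% f x (mlieBracket I X Y x)
      = d% (fun y ↦ d% f y (Y y)) x (X x) - d% (fun y ↦ d% f y (X y)) x (Y x) := by
  by_cases hw : ∃ w : TangentSpace I x, w ≠ 0
  swap
  · push Not at hw
    rw [hw (mlieBracket I X Y x), hw (X x), hw (Y x)]
    simp
  obtain ⟨w, hw⟩ := hw
  set Z := FiberBundle.extend E w
  have hZ : CMDiffAt ∞ (T% Z) x := FiberBundle.contMDiffAt_extend I E w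
  have hZx : Z x = w := by simp [Z]
  have := isManifold_minSmoothness_three I M
  have h2 {U : Π x : M, TangentSpace I x} (hU : CMDiffAt ∞ (T% U) x) :
      CMDiffAt (minSmoothness ℝ 2) (T% U) x := hU.of_le (by
        rw [minSmoothness_of_isRCLikeNormedField]; exact ENat.LEInfty.out)
  have h1 {U : Π x : M, TangentSpace I x} (hU : CMDiffAt ∞ (T% U) x) :
      MDiffAt (T% U) x := hU.mdifferentiableAt (by simp)
  have key {U V : Π x : M, TangentSpace I x} (hU : CMDiffAt ∞ (T% U) x)
      (hV : CMDiffAt ∞ (T% V) x) : mlieBracket I U (mlieBracket I V (f • Z)) x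
        = d% (fun y ↦ d% f y (V y)) x (U x) • w + d% f x (V x) • mlieBracket I U Z x
          + (d% f x (U x) • mlieBracket I V Z x + f x • mlieBracket I U (mlieBracket I V Z) x) := by
    have hfV := contMDiffAt_mvfderiv_apply hf hV
    rw [Filter.EventuallyEq.mlieBracket_vectorField_eq (EventuallyEq.refl _ U)
        (mlieBracket_smul_right_eventuallyEq (Y := V) hf hZ),
      mlieBracket_add_right (h1 (hfV.smul_section hZ)) (h1 (hf.smul_section (contMDiffAt_mlieBracket hV hZ))),
      mlieBracket_smul_right (hfV.mdifferentiableAt (by simp)) (h1 hZ),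
      mlieBracket_smul_right (hf.mdifferentiableAt (by simp)) (h1 (contMDiffAt_mlieBracket hV hZ)), hZx]
  have J := leibniz_identity_mlieBracket_apply (h2 hX) (h2 hY) (h2 (hf.smul_section hZ))
  have J' := leibniz_identity_mlieBracket_apply (h2 hX) (h2 hY) (h2 hZ)
  rw [key hX hY, key hY hX, mlieBracket_smul_right (hf.mdifferentiableAt (by simp)) (h1 hZ), J',
    hZx] at J
  have : (d% f x (mlieBracket I X Y x) - (d% (fun y ↦ d% f y (Y y)) x (X x)
      - d% (fun y ↦ d% f y (X y)) x (Y x))) • w = 0 := by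
    rw [← sub_eq_zero] at J
    rw [← neg_eq_zero, ← J]
    module
  rcases smul_eq_zero.1 this with h | h
  · linarith
  · exact absurd h hw

end Calculus

section Metric
variable {E : Type*} [NormedAddCommGroup E] [NormedSpace ℝ E] [FiniteDimensional ℝ E]
  {H : Type*} [TopologicalSpace H] {I : ModelWithCorners ℝ E H}
  {M : Type*} [TopologicalSpace M] [ChartedSpace H M] [IsManifold I ∞ M]
  [RiemannianBundle (fun x : M ↦ TangentSpace I x)]
  [IsContMDiffRiemannianBundle I ∞ E (fun x : M ↦ TangentSpace I x)]

theorem contMDiffAt_pairing {X Y : Π x : M, TangentSpace I x} {x : M}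
    (hX : CMDiffAt ∞ (T% X) x) (hY : CMDiffAt ∞ (T% Y) x) : CMDiffAt ∞ (pairing X Y) x :=
  ContMDiffAt.inner_bundle (E := fun x : M ↦ TangentSpace I x) hX hY

theorem contMDiffAt_gramSchmidt {d : ℕ} {s : Fin d → Π x : M, TangentSpace I x} {x : M}
    (hs : ∀ i, CMDiffAt ∞ (T% (s i)) x) (hli : LinearIndependent ℝ (fun i ↦ s i x)) (i : Fin d) :
    CMDiffAt ∞ (T% (fun y ↦ gramSchmidt ℝ (fun j ↦ s j y) i)) x := by
  induction i using WellFoundedLT.induction with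
  | ind i ih =>
    have : (fun y ↦ gramSchmidt ℝ (fun j ↦ s j y) i) = (fun y ↦ s i y - ∑ j ∈ Finset.Iio i,
        ((pairing (fun y ↦ gramSchmidt ℝ (fun k ↦ s k y) j) (s i) y
          / pairing (fun y ↦ gramSchmidt ℝ (fun k ↦ s k y) j)
            (fun y ↦ gramSchmidt ℝ (fun k ↦ s k y) j) y) •
              gramSchmidt ℝ (fun k ↦ s k y) j : TangentSpace I y)) := by
      ext1 y
      rw [gramSchmidt_def]
      simp only [Submodule.starProjection_singleton, pairing, real_inner_self_eq_norm_sq]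
      rfl
    refine contMDiffAt_field_congr ?_ (Eventually.of_forall (congrFun this.symm))
    refine (hs i).sub_section (ContMDiffAt.sum_section fun j hj ↦ ?_)
    have hj' := ih j (Finset.mem_Iio.1 hj)
    refine ContMDiffAt.smul_section (f := fun y ↦ _ / _) ((contMDiffAt_pairing hj' (hs i)).div₀
      (contMDiffAt_pairing hj' hj') ?_) hj'
    simpa [pairing] using gramSchmidt_ne_zero j hli

theorem exists_orthonormal_frame {d : ℕ} {s : Fin d → Π x : M, TangentSpace I x} {x : M}
    (hs : ∀ i, CMDiffAt ∞ (T% (s i)) x) (hli : LinearIndependent ℝ (fun i ↦ s i x)) :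
    ∃ e : Fin d → Π x : M, TangentSpace I x, (∀ i, CMDiffAt ∞ (T% (e i)) x) ∧
      (∀ᶠ y in 𝓝 x, Orthonormal ℝ (fun i ↦ e i y)) ∧
      (∀ y, Submodule.span ℝ (range fun i ↦ e i y) = Submodule.span ℝ (range fun i ↦ s i y)) ∧
      (Orthonormal ℝ (fun i ↦ s i x) → ∀ i, e i x = s i x) := by
  set g : Fin d → Π x : M, TangentSpace I x := fun i y ↦ gramSchmidt ℝ (fun j ↦ s j y) i with hg
  have hgs : ∀ i, CMDiffAt ∞ (T% (g i)) x := contMDiffAt_gramSchmidt hs hli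
  have hgg : ∀ i, CMDiffAt ∞ (pairing (g i) (g i)) x := fun i ↦ contMDiffAt_pairing (hgs i) (hgs i)
  have hne : ∀ i, pairing (g i) (g i) x ≠ 0 := fun i ↦ by
    simpa [pairing] using gramSchmidt_ne_zero i hli
  refine ⟨fun i y ↦ gramSchmidtNormed ℝ (fun j ↦ s j y) i, fun i ↦ ?_, ?_, fun y ↦ ?_, ?_⟩
  · have : (fun y ↦ gramSchmidtNormed ℝ (fun j ↦ s j y) i)
        = (fun y ↦ (Real.sqrt (pairing (g i) (g i) y))⁻¹) • g i := by
      ext1 y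
      simp only [gramSchmidtNormed, norm_eq_sqrt_real_inner]
      rfl
    refine contMDiffAt_field_congr ?_ (Eventually.of_forall (congrFun this.symm))
    refine ContMDiffAt.smul_section (ContMDiffAt.inv₀ ?_ ?_) (hgs i)
    · exact (Real.contDiffAt_sqrt (hne i)).contMDiffAt.comp x (hgg i)
    · exact (Real.sqrt_ne_zero real_inner_self_nonneg).2 (hne i)
  · have : ∀ᶠ y in 𝓝 x, ∀ i, pairing (g i) (g i) y ≠ 0 :=
      eventually_all.2 fun i ↦ (hgg i).continuousAt.eventually_ne (hne i)
    filter_upwards [this] with y hy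
    have hy' : ∀ i, gramSchmidt ℝ (fun j ↦ s j y) i ≠ 0 := fun i h ↦ hy i (by simp [pairing, hg, h])
    refine ⟨fun i ↦ gramSchmidtNormed_unit_length' ?_, fun i j hij ↦ ?_⟩
    · simpa [gramSchmidtNormed] using hy' i
    · simp [gramSchmidtNormed, inner_smul_left, inner_smul_right, gramSchmidt_orthogonal ℝ _ hij]
  · rw [span_gramSchmidtNormed_range, span_gramSchmidt]
  · intro ho i
    simp [gramSchmidtNormed, gramSchmidt_of_orthogonal ℝ ho.2, ho.1 i]

theorem exists_orthonormal_frame_tangentSpace (x : M) :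
    ∃ e : Fin (Module.finrank ℝ E) → Π x : M, TangentSpace I x, (∀ i, CMDiffAt ∞ (T% (e i)) x) ∧
      ∀ᶠ y in 𝓝 x, ∀ v : TangentSpace I y, v = ∑ i, inner ℝ (e i y) v • e i y := by
  have hfr : ∀ y : M, Module.finrank ℝ (TangentSpace I y) = Module.finrank ℝ E := fun y ↦ rfl
  let b : OrthonormalBasis (Fin (Module.finrank ℝ E)) ℝ (TangentSpace I x) :=
    stdOrthonormalBasis ℝ (TangentSpace I x)
  obtain ⟨e, he, ho, -, -⟩ := exists_orthonormal_frame (I := I) (x := x)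
    (s := fun i ↦ FiberBundle.extend E (b i))
    (fun i ↦ FiberBundle.contMDiffAt_extend I E _)
    (by simpa using b.orthonormal.linearIndependent)
  refine ⟨e, he, ho.mono fun y hy v ↦ ?_⟩
  let b' := OrthonormalBasis.mk hy (hy.linearIndependent.span_eq_top_of_card_eq_finrank'
    (by simp [hfr])).ge
  conv_lhs => rw [← b'.sum_repr' v]
  simp [b']

theorem contMDiffAt_of_pairing {X : Π x : M, TangentSpace I x} {x : M}
    (h : ∀ Z : Π x : M, TangentSpace I x, CMDiffAt ∞ (T% Z) x → CMDiffAt ∞ (pairing Z X) x) :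
    CMDiffAt ∞ (T% X) x := by
  obtain ⟨e, he, hs⟩ := exists_orthonormal_frame_tangentSpace (I := I) x
  have : CMDiffAt ∞ (T% (fun y ↦ ∑ i, (pairing (e i) X • e i) y)) x :=
    ContMDiffAt.sum_section fun i _ ↦ (h _ (he i)).smul_section (he i)
  refine this.congr_of_eventuallyEq (hs.mono fun y hy ↦ ?_)
  simp only [TotalSpace.mk_inj]
  exact hy (X y)

theorem contMDiffAt_koszul {X Y Z : Π x : M, TangentSpace I x} {x : M}
    (hX : CMDiffAt ∞ (T% X) x) (hY : CMDiffAt ∞ (T% Y) x) (hZ : CMDiffAt ∞ (T% Z) x) :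
    CMDiffAt ∞ (koszul (I := I) Y X Z) x := by
  have h {U V W : Π x : M, TangentSpace I x} (hU : CMDiffAt ∞ (T% U) x)
      (hV : CMDiffAt ∞ (T% V) x) (hW : CMDiffAt ∞ (T% W) x) :=
    contMDiffAt_mvfderiv_apply (contMDiffAt_pairing hU hV) hW
  have h' {U V W : Π x : M, TangentSpace I x} (hU : CMDiffAt ∞ (T% U) x)
      (hV : CMDiffAt ∞ (T% V) x) (hW : CMDiffAt ∞ (T% W) x) :=
    contMDiffAt_pairing (contMDiffAt_mlieBracket hU hV) hW
  exact (contMDiffAt_const (c := (1 / 2 : ℝ))).mul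
    ((((((h hY hZ hX).add (h hX hZ hY)).sub (h hX hY hZ)).add (h' hX hY hZ)).sub
      (h' hX hZ hY)).sub (h' hY hZ hX))

theorem contMDiffAt_nabla {X Y : Π x : M, TangentSpace I x} {x : M}
    (hX : CMDiffAt ∞ (T% X) x) (hY : CMDiffAt ∞ (T% Y) x) : CMDiffAt ∞ (T% (nabla I X Y)) x := by
  refine contMDiffAt_of_pairing fun Z hZ ↦ ?_
  refine (contMDiffAt_koszul hX hY hZ).congr_of_eventuallyEq ?_
  filter_upwards [eventually_mdifferentiableAt hX, eventually_mdifferentiableAt hY,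
    eventually_mdifferentiableAt hZ] with y h1 h2 h3
  rw [pairing_comm]
  exact inner_leviCivita h2 h1 h3

theorem mdifferentiableAt_nabla {X Y : Π x : M, TangentSpace I x} {x : M}
    (hX : MDiffAt (T% X) x) (hY : CMDiffAt ∞ (T% Y) x) : MDiffAt (T% (nabla I X Y)) x := by
  obtain ⟨e, he, hs⟩ := exists_orthonormal_frame_tangentSpace (I := I) x
  have : MDiffAt (T% (fun y ↦ ∑ i, (pairing (e i) X • nabla I (e i) Y) y)) x :=
    MDifferentiableAt.sum_section fun i _ ↦
      (mdifferentiableAt_pairing ((he i).mdifferentiableAt (by simp)) hX).smul_section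
        ((contMDiffAt_nabla (he i) hY).mdifferentiableAt (by simp))
  refine this.congr_of_eventuallyEq (hs.mono fun y hy ↦ ?_)
  simp only [TotalSpace.mk_inj]
  conv_lhs => rw [nabla, hy (X y)]
  simp [pairing, nabla]

theorem mvfderiv_pairing {Y Z : Π x : M, TangentSpace I x} {x : M}
    (hY : MDiffAt (T% Y) x) (hZ : MDiffAt (T% Z) x) (v : TangentSpace I x) :
    d% (pairing Y Z) x v
      = inner ℝ (leviCivita I M Y x v) (Z x) + inner ℝ (Y x) (leviCivita I M Z x v) := by
  have := leviCivita_metric (FiberBundle.mdifferentiableAt_extend I E v) hY hZ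
  simp only [FiberBundle.extend_apply_self] at this
  exact this

theorem nabla_sub_nabla {X Y : Π x : M, TangentSpace I x} {x : M}
    (hX : MDiffAt (T% X) x) (hY : MDiffAt (T% Y) x) :
    leviCivita I M Y x (X x) - leviCivita I M X x (Y x) = mlieBracket I X Y x :=
  (CovariantDerivative.torsion_eq_zero_iff _).1 leviCivita_torsion hX hY

theorem curvatureField_tensorial (Y : Π x : M, TangentSpace I x)
    {Z : Π x : M, TangentSpace I x} {x : M} (hZ : CMDiffAt ∞ (T% Z) x) :
    TensorialAt I E (fun X ↦ curvatureField I X Y Z x) x where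
  smul {f X} hf hX := by
    have h : nabla I (f • X) Z = f • nabla I X Z := by ext1 y; simp [nabla]
    simp only [curvatureField, h]
    simp only [nabla, Pi.smul_apply', map_smul, mlieBracket_smul_left hf hX, map_add]
    rw [show leviCivita I M (f • nabla I X Z) x = _ from
      (leviCivita I M).isCovariantDerivativeOnUniv.leibniz (mdifferentiableAt_nabla hX hZ) hf]
    simp [nabla]
    module
  add {X X'} hX hX' := by
    have h : nabla I (X + X') Z = nabla I X Z + nabla I X' Z := by ext1 y; simp [nabla]
    simp only [curvatureField, h]
    simp only [nabla, Pi.add_apply, map_add, mlieBracket_add_left hX hX']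
    rw [show leviCivita I M (nabla I X Z + nabla I X' Z) x = _ from
      (leviCivita I M).isCovariantDerivativeOnUniv.add (mdifferentiableAt_nabla hX hZ)
        (mdifferentiableAt_nabla hX' hZ)]
    simp
    module

theorem curvatureField_swap (X Y Z : Π x : M, TangentSpace I x) (x : M) :
    curvatureField I X Y Z x = -curvatureField I Y X Z x := by
  simp only [curvatureField, nabla, mlieBracket_swap_apply (V := X) (W := Y), map_neg]
  module

theorem curvatureField_congr {X X' Y Y' Z : Π x : M, TangentSpace I x} {x : M}
    (hX : MDiffAt (T% X) x) (hX' : MDiffAt (T% X') x) (hY : MDiffAt (T% Y) x)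
    (hY' : MDiffAt (T% Y') x) (hZ : CMDiffAt ∞ (T% Z) x) (h : X x = X' x) (h' : Y x = Y' x) :
    curvatureField I X Y Z x = curvatureField I X' Y' Z x := by
  rw [(curvatureField_tensorial Y hZ).pointwise hX hX' h, curvatureField_swap X' Y,
    (curvatureField_tensorial X' hZ).pointwise hY hY' h', ← curvatureField_swap]

theorem inner_curvatureField_swap {X Y Z W : Π x : M, TangentSpace I x} {x : M}
    (hX : CMDiffAt ∞ (T% X) x) (hY : CMDiffAt ∞ (T% Y) x) (hZ : CMDiffAt ∞ (T% Z) x)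
    (hW : CMDiffAt ∞ (T% W) x) :
    inner ℝ (curvatureField I X Y Z x) (W x) = -inner ℝ (Z x) (curvatureField I X Y W x) := by
  have h1 {U : Π x : M, TangentSpace I x} (hU : CMDiffAt ∞ (T% U) x) :
      MDiffAt (T% U) x := hU.mdifferentiableAt (by simp)
  have key {U V : Π x : M, TangentSpace I x} (hU : CMDiffAt ∞ (T% U) x)
      (hV : CMDiffAt ∞ (T% V) x) : d% (fun y ↦ d% (pairing Z W) y (V y)) x (U x)
      = inner ℝ (nabla I U (nabla I V Z) x) (W x) + inner ℝ (nabla I V Z x) (nabla I U W x)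
        + (inner ℝ (nabla I U Z x) (nabla I V W x)
          + inner ℝ (Z x) (nabla I U (nabla I V W) x)) := by
    have : (fun y ↦ d% (pairing Z W) y (V y)) =ᶠ[𝓝 x]
        pairing (nabla I V Z) W + pairing Z (nabla I V W) := by
      filter_upwards [eventually_mdifferentiableAt hZ, eventually_mdifferentiableAt hW] with y h2 h3
      exact mvfderiv_pairing h2 h3 _
    have e : d% (fun y ↦ d% (pairing Z W) y (V y)) x
        = d% (pairing (nabla I V Z) W + pairing Z (nabla I V W)) x := mvfderiv_congr this
    have hVZ := h1 (contMDiffAt_nabla hV hZ)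
    have hVW := h1 (contMDiffAt_nabla hV hW)
    rw [e, mvfderiv_add (mdifferentiableAt_pairing hVZ (h1 hW))
      (mdifferentiableAt_pairing (h1 hZ) hVW), add_apply, mvfderiv_pairing hVZ (h1 hW),
      mvfderiv_pairing (h1 hZ) hVW]
    rfl
  have := mvfderiv_mlieBracket (contMDiffAt_pairing hZ hW) hX hY
  rw [key hX hY, key hY hX, mvfderiv_pairing (h1 hZ) (h1 hW)] at this
  simp only [curvatureField, inner_sub_left, inner_sub_right]
  simp only [nabla] at this ⊢
  linarith

end Metric
end FoliatedManifold

theorem Submodule.starProjection_eq_sum_of_orthonormal {V : Type*} [NormedAddCommGroup V]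
    [InnerProductSpace ℝ V] {ι : Type*} [Fintype ι] (U : Submodule ℝ V)
    [U.HasOrthogonalProjection] {e : ι → V} (he : Orthonormal ℝ e)
    (hU : Submodule.span ℝ (range e) = U) (v : V) :
    U.starProjection v = ∑ i, inner ℝ (e i) v • e i := by
  classical
  subst hU
  refine Submodule.eq_starProjection_of_mem_orthogonal (K := Submodule.span ℝ (range e)) ?_ ?_
  · exact Submodule.sum_mem _ fun i _ ↦ Submodule.smul_mem _ _ (Submodule.subset_span ⟨i, rfl⟩)
  · rw [Submodule.mem_orthogonal']
    intro u hu
    induction hu using Submodule.span_induction with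
    | mem u hu =>
      obtain ⟨j, rfl⟩ := hu
      rw [inner_sub_left, sum_inner]
      simp only [real_inner_smul_left, orthonormal_iff_ite.1 he]
      simp [real_inner_comm]
    | zero => simp
    | add u w _ _ hu hw => rw [inner_add_right, hu, hw, add_zero]
    | smul a u _ hu => rw [inner_smul_right, hu, mul_zero]

namespace Foliation

section Charts
variable {E : Type*} [NormedAddCommGroup E] [NormedSpace ℝ E]
  {H : Type*} [TopologicalSpace H] {I : ModelWithCorners ℝ E H}
  {M : Type*} [TopologicalSpace M] [ChartedSpace H M] {d c : ℕ}
  (F : Foliation I M d c)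
  {φ : OpenPartialHomeomorph M (EuclideanSpace ℝ (Fin d) × EuclideanSpace ℝ (Fin c))} {x : M}

variable {F} in
theorem contMDiffAt_chart (hφ : φ ∈ F.charts) (hx : x ∈ φ.source) :
    ContMDiffAt I 𝓘(ℝ, EuclideanSpace ℝ (Fin d) × EuclideanSpace ℝ (Fin c)) ∞ φ x :=
  (F.contMDiffOn φ hφ).contMDiffAt (φ.open_source.mem_nhds hx)

variable {F} in
theorem contMDiffAt_transverse (hφ : φ ∈ F.charts) (hx : x ∈ φ.source) :
    ContMDiffAt I 𝓘(ℝ, EuclideanSpace ℝ (Fin c)) ∞ (fun y ↦ (φ y).2) x :=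
  contDiff_snd.contMDiff.contMDiffAt.comp x (contMDiffAt_chart hφ hx)

variable {F} in
theorem mdifferentiable_chart (hφ : φ ∈ F.charts) :
    φ.MDifferentiable I 𝓘(ℝ, EuclideanSpace ℝ (Fin d) × EuclideanSpace ℝ (Fin c)) :=
  ⟨(F.contMDiffOn φ hφ).mdifferentiableOn (by simp),
    (F.contMDiffOn_symm φ hφ).mdifferentiableOn (by simp)⟩

variable {F} in
theorem mfderiv_transverse (hφ : φ ∈ F.charts) (hx : x ∈ φ.source) (v : TangentSpace I x) :
    mfderiv I 𝓘(ℝ, EuclideanSpace ℝ (Fin c)) (fun y ↦ (φ y).2) x v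
      = (mfderiv I 𝓘(ℝ, EuclideanSpace ℝ (Fin d) × EuclideanSpace ℝ (Fin c)) φ x v :
        EuclideanSpace ℝ (Fin d) × EuclideanSpace ℝ (Fin c)).2 := by
  have hs : MDifferentiableAt 𝓘(ℝ, EuclideanSpace ℝ (Fin d) × EuclideanSpace ℝ (Fin c))
      𝓘(ℝ, EuclideanSpace ℝ (Fin c)) Prod.snd (φ x) :=
    differentiableAt_snd.mdifferentiableAt
  refine (mfderiv_comp_apply x hs ((contMDiffAt_chart hφ hx).mdifferentiableAt (by simp)) v).trans ?_
  rw [mfderiv_eq_fderiv, fderiv_snd]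
  rfl

variable {F} in
theorem ker_transverse_le {ψ : OpenPartialHomeomorph M
      (EuclideanSpace ℝ (Fin d) × EuclideanSpace ℝ (Fin c))}
    (hφ : φ ∈ F.charts) (hx : x ∈ φ.source) (hψ : ψ ∈ F.charts) (hx' : x ∈ ψ.source) :
    (mfderiv I 𝓘(ℝ, EuclideanSpace ℝ (Fin c)) (fun y ↦ (φ y).2) x).ker
      ≤ (mfderiv I 𝓘(ℝ, EuclideanSpace ℝ (Fin c)) (fun y ↦ (ψ y).2) x).ker := by
  obtain ⟨U, hU, hUc⟩ := F.compatible φ hφ ψ hψ x ⟨hx, hx'⟩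
  set k : EuclideanSpace ℝ (Fin c) → EuclideanSpace ℝ (Fin c) :=
    fun b ↦ (ψ (φ.symm ((φ x).1, b))).2 with hk
  have hpr : ContDiff ℝ ∞ (fun b : EuclideanSpace ℝ (Fin c) ↦ ((φ x).1, b)) :=
    contDiff_const.prodMk contDiff_id
  have hsymm : ContMDiffAt 𝓘(ℝ, EuclideanSpace ℝ (Fin c)) I ∞
      (fun b : EuclideanSpace ℝ (Fin c) ↦ φ.symm ((φ x).1, b)) (φ x).2 :=
    ((F.contMDiffOn_symm φ hφ).contMDiffAt (φ.open_target.mem_nhds (φ.map_source hx))).comp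
      (φ x).2 hpr.contMDiff.contMDiffAt
  have hkd : ContMDiffAt 𝓘(ℝ, EuclideanSpace ℝ (Fin c)) 𝓘(ℝ, EuclideanSpace ℝ (Fin c)) ∞ k
      (φ x).2 := by
    refine ContMDiffAt.comp (g := fun y ↦ (ψ y).2) (I' := I) (φ x).2 ?_ hsymm
    simp only [Prod.mk.eta, φ.left_inv hx]
    exact contMDiffAt_transverse hψ hx'
  have heq : (fun y ↦ (ψ y).2) =ᶠ[𝓝 x] k ∘ (fun y ↦ (φ y).2) := by
    have hc : ContinuousAt (fun y ↦ φ.symm ((φ x).1, (φ y).2)) x :=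
      ContinuousAt.comp (f := fun y ↦ (φ y).2)
        (g := fun b : EuclideanSpace ℝ (Fin c) ↦ φ.symm ((φ x).1, b)) hsymm.continuousAt
        (contMDiffAt_transverse hφ hx).continuousAt
    have hc2 : ContinuousAt (fun y ↦ ((φ x).1, (φ y).2)) x :=
      continuousAt_const.prodMk (contMDiffAt_transverse hφ hx).continuousAt
    have h1 : ∀ᶠ y in 𝓝 x, φ.symm ((φ x).1, (φ y).2) ∈ U := hc (by simpa [φ.left_inv hx] using hU)
    have h2 : ∀ᶠ y in 𝓝 x, ((φ x).1, (φ y).2) ∈ φ.target :=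
      hc2 (φ.open_target.mem_nhds (φ.map_source hx))
    filter_upwards [hU, h1, h2] with y hy hy1 hy2
    exact hUc y hy _ hy1 (by rw [φ.right_inv hy2])
  intro v hv
  rw [LinearMap.mem_ker] at hv ⊢
  have h := mfderiv_comp_apply x (hkd.mdifferentiableAt (by simp))
    ((contMDiffAt_transverse hφ hx).mdifferentiableAt (by simp)) v
  erw [hv, map_zero] at h
  exact (congrArg (fun L : TangentSpace I x →L[ℝ] EuclideanSpace ℝ (Fin c) ↦ L v)
    heq.mfderiv_eq).trans h

variable {F} in
theorem tangent_eq_ker (hφ : φ ∈ F.charts) (hx : x ∈ φ.source) :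
    F.tangent x = (mfderiv I 𝓘(ℝ, EuclideanSpace ℝ (Fin c)) (fun y ↦ (φ y).2) x).ker :=
  le_antisymm (iInf₂_le_of_le φ hφ (iInf_le _ hx))
    (le_iInf₂ fun _ hψ ↦ le_iInf fun hx' ↦ ker_transverse_le hφ hx hψ hx')

theorem samePlaque_symm {F : Foliation I M d c} {x y : M} (h : F.SamePlaque x y) :
    F.SamePlaque y x := by
  obtain ⟨φ, hφ, hx, hy, h⟩ := h
  exact ⟨φ, hφ, hy, hx, h.symm⟩

theorem eventually_samePlaque {F : Foliation I M d c} {γ : ℝ → M}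
    {w : ∀ t, TangentSpace I (γ t)} {t₀ : ℝ}
    (hγ : ∀ᶠ t in 𝓝 t₀, HasMFDerivAt 𝓘(ℝ, ℝ) I γ t ((1 : ℝ →L[ℝ] ℝ).smulRight (w t)))
    (hw : ∀ t, w t ∈ F.tangent (γ t)) : ∀ᶠ t in 𝓝 t₀, F.SamePlaque (γ t₀) (γ t) := by
  obtain ⟨φ, hφ, hx⟩ := F.exists_mem_source (γ t₀)
  have hc : ContinuousAt γ t₀ := hγ.self_of_nhds.1
  obtain ⟨ε, hε, hball⟩ := Metric.eventually_nhds_iff_ball.1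
    (hγ.and (hc (φ.open_source.mem_nhds hx)))
  have hd : ∀ t ∈ Metric.ball t₀ ε, HasDerivAt (fun t ↦ (φ (γ t)).2) 0 t := by
    intro t ht
    obtain ⟨h1, h2⟩ := hball t ht
    have h3 := ((contMDiffAt_transverse hφ h2).mdifferentiableAt (by simp)).hasMFDerivAt
    have h4 : HasMFDerivAt 𝓘(ℝ, ℝ) 𝓘(ℝ, EuclideanSpace ℝ (Fin c)) (fun t ↦ (φ (γ t)).2) t
        (0 : ℝ →L[ℝ] EuclideanSpace ℝ (Fin c)) := by
      refine (h3.comp t h1).congr_mfderiv ?_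
      have := hw t
      rw [tangent_eq_ker hφ h2, LinearMap.mem_ker] at this
      refine ContinuousLinearMap.ext fun (r : ℝ) ↦ ?_
      refine (map_smul (mfderiv I 𝓘(ℝ, EuclideanSpace ℝ (Fin c)) (fun y ↦ (φ y).2) (γ t))
        r (w t)).trans ?_
      erw [this, smul_zero]
      rfl
    have h5 : HasFDerivAt (fun t ↦ (φ (γ t)).2) (0 : ℝ →L[ℝ] EuclideanSpace ℝ (Fin c)) t :=
      hasMFDerivAt_iff_hasFDerivAt.1 h4
    simpa using h5.hasDerivAt
  filter_upwards [Metric.ball_mem_nhds t₀ hε] with t ht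
  refine ⟨φ, hφ, hx, (hball t ht).2, ?_⟩
  exact Metric.isOpen_ball.is_const_of_deriv_eq_zero (convex_ball t₀ ε).isPreconnected
    (fun s hs ↦ (hd s hs).differentiableAt.differentiableWithinAt) (fun s hs ↦ (hd s hs).deriv)
    (Metric.mem_ball_self hε) ht

theorem mem_leaf_of_isMIntegralCurveOn {F : Foliation I M d c} {γ : ℝ → M}
    {W : ∀ x, TangentSpace I x} {a b s t : ℝ} (hγ : IsMIntegralCurveOn γ W (Ioo a b))
    (hW : ∀ x, W x ∈ F.tangent x) (hs : s ∈ Ioo a b) (ht : t ∈ Ioo a b) :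
    γ t ∈ F.leaf (γ s) := by
  refine isPreconnected_Ioo.induction₂ (fun s t ↦ Relation.ReflTransGen F.SamePlaque (γ s) (γ t))
    (fun u hu ↦ ?_) (fun u v w _ _ _ h h' ↦ h.trans h') (fun u v _ _ h ↦ ?_) hs ht
  · exact ((eventually_samePlaque (hγ.isMIntegralCurveAt (isOpen_Ioo.mem_nhds hu))
      fun t ↦ hW _).mono fun v hv ↦ .single hv).filter_mono nhdsWithin_le_nhds
  · have : Std.Symm F.SamePlaque := ⟨fun _ _ ↦ samePlaque_symm⟩
    exact Std.Symm.symm _ _ h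

variable [FiniteDimensional ℝ E] [IsManifold I ∞ M]

theorem mlieBracket_mem_tangent {F : Foliation I M d c} {X Y : Π x : M, TangentSpace I x} {x : M}
    (hX : CMDiffAt ∞ (T% X) x) (hY : CMDiffAt ∞ (T% Y) x)
    (hXF : ∀ᶠ y in 𝓝 x, X y ∈ F.tangent y) (hYF : ∀ᶠ y in 𝓝 x, Y y ∈ F.tangent y) :
    mlieBracket I X Y x ∈ F.tangent x := by
  obtain ⟨φ, hφ, hx⟩ := F.exists_mem_source x
  let g (k : Fin c) (y : M) : ℝ := (φ y).2 k
  have hsm (k : Fin c) {y : M} (hy : y ∈ φ.source) : CMDiffAt ∞ (g k) y :=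
    (EuclideanSpace.proj (𝕜 := ℝ) k).contDiff.contMDiff.contMDiffAt.comp y
      (contMDiffAt_transverse hφ hy)
  have hmf (k : Fin c) {y : M} (hy : y ∈ φ.source) (v : TangentSpace I y) :
      d% (g k) y v = (d% (fun y ↦ (φ y).2) y v) k := by
    have hs : MDifferentiableAt 𝓘(ℝ, EuclideanSpace ℝ (Fin c)) 𝓘(ℝ, ℝ)
        (EuclideanSpace.proj (𝕜 := ℝ) k) ((φ y).2) :=
      (EuclideanSpace.proj (𝕜 := ℝ) k).differentiableAt.mdifferentiableAt
    refine (mfderiv_comp_apply y hs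
      ((contMDiffAt_transverse hφ hy).mdifferentiableAt (by simp)) v).trans ?_
    rw [mfderiv_eq_fderiv, ContinuousLinearMap.fderiv]
    rfl
  have hmem {y : M} (hy : y ∈ φ.source) (v : TangentSpace I y) :
      v ∈ F.tangent y ↔ ∀ k, d% (g k) y v = 0 := by
    rw [tangent_eq_ker hφ hy, LinearMap.mem_ker]
    simp only [hmf _ hy]
    exact ⟨fun h k ↦ congrArg (fun w : EuclideanSpace ℝ (Fin c) ↦ w k) h, fun h ↦ PiLp.ext h⟩
  rw [hmem hx]
  intro k
  have hz {Z : Π x : M, TangentSpace I x} (hZ : ∀ᶠ y in 𝓝 x, Z y ∈ F.tangent y) :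
      (fun y ↦ d% (g k) y (Z y)) =ᶠ[𝓝 x] fun _ ↦ (0 : ℝ) := by
    filter_upwards [hZ, φ.open_source.mem_nhds hx] with y h1 h2
    exact (hmem h2 _).1 h1 k
  rw [mvfderiv_mlieBracket (hsm k hx) hX hY, mvfderiv_congr (hz hXF), mvfderiv_congr (hz hYF),
    mvfderiv_const]
  simp

end Charts
section Frames
variable {E : Type*} [NormedAddCommGroup E] [NormedSpace ℝ E] [FiniteDimensional ℝ E]
  {H : Type*} [TopologicalSpace H] {I : ModelWithCorners ℝ E H}
  {M : Type*} [TopologicalSpace M] [ChartedSpace H M] [IsManifold I ∞ M] {d c : ℕ}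

theorem exists_contMDiffAt_frame (F : Foliation I M d c) (x : M) :
    ∃ s : Fin d → Π x : M, TangentSpace I x, (∀ i, CMDiffAt ∞ (T% (s i)) x) ∧
      ∀ᶠ y in 𝓝 x, LinearIndependent ℝ (fun i ↦ s i y) ∧
        Submodule.span ℝ (range fun i ↦ s i y) = F.tangent y := by
  obtain ⟨φ, hφ, hx⟩ := F.exists_mem_source x
  let V (i : Fin d) : Π _ : EuclideanSpace ℝ (Fin d) × EuclideanSpace ℝ (Fin c),
    EuclideanSpace ℝ (Fin d) × EuclideanSpace ℝ (Fin c) := fun _ ↦ (EuclideanSpace.single i 1, 0)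
  let L {y : M} (hy : y ∈ φ.source) := (mdifferentiable_chart hφ).mfderiv hy
  have hL {y : M} (hy : y ∈ φ.source) : mfderiv I
      𝓘(ℝ, EuclideanSpace ℝ (Fin d) × EuclideanSpace ℝ (Fin c)) φ y = L hy := rfl
  refine ⟨fun i ↦ mpullback I 𝓘(ℝ, EuclideanSpace ℝ (Fin d) × EuclideanSpace ℝ (Fin c)) φ (V i),
    fun i ↦ ?_, ?_⟩
  · refine ContMDiffAt.mpullback_vectorField_preimage (n := ∞) ?_ (contMDiffAt_chart hφ hx)
      ⟨L hx, rfl⟩ (by simp)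
    exact contMDiffAt_vectorSpace_iff_contDiffAt.2 contDiffAt_const
  · filter_upwards [φ.open_source.mem_nhds hx] with y hy
    set A := (L hy).symm with hA
    have hval (i : Fin d) : mpullback I
        𝓘(ℝ, EuclideanSpace ℝ (Fin d) × EuclideanSpace ℝ (Fin c)) φ (V i) y
        = A (EuclideanSpace.single i (1 : ℝ), (0 : EuclideanSpace ℝ (Fin c))) := by
      change (mfderiv I 𝓘(ℝ, EuclideanSpace ℝ (Fin d) × EuclideanSpace ℝ (Fin c)) φ y).inverse _ = _
      rw [hL hy, ContinuousLinearMap.inverse_equiv]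
      rfl
    let B : EuclideanSpace ℝ (Fin d) →ₗ[ℝ] TangentSpace I y :=
      A.toLinearEquiv.toLinearMap ∘ₗ LinearMap.inl ℝ _ (EuclideanSpace ℝ (Fin c))
    have hB : Function.Injective B := A.injective.comp LinearMap.inl_injective
    have hBs : (fun i ↦ mpullback I
        𝓘(ℝ, EuclideanSpace ℝ (Fin d) × EuclideanSpace ℝ (Fin c)) φ (V i) y)
        = B ∘ EuclideanSpace.basisFun (Fin d) ℝ := by
      ext1 i
      rw [hval, Function.comp_apply, EuclideanSpace.basisFun_apply]
      rfl
    rw [hBs]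
    refine ⟨((EuclideanSpace.basisFun (Fin d) ℝ).orthonormal.linearIndependent).map' B
      (LinearMap.ker_eq_bot.2 hB), ?_⟩
    have htop : Submodule.span ℝ (range (EuclideanSpace.basisFun (Fin d) ℝ)) = ⊤ := by
      rw [← OrthonormalBasis.coe_toBasis, Module.Basis.span_eq]
    rw [range_comp, Submodule.span_image, htop, Submodule.map_top, tangent_eq_ker hφ hy]
    ext v
    rw [LinearMap.mem_range, LinearMap.mem_ker]
    constructor
    · rintro ⟨a, rfl⟩
      refine (mfderiv_transverse hφ hy (B a)).trans ?_
      rw [hL hy]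
      exact congrArg Prod.snd ((L hy).apply_symm_apply (a, (0 : EuclideanSpace ℝ (Fin c))))
    · intro hv
      have hv' := (mfderiv_transverse hφ hy v).symm.trans hv
      rw [hL hy] at hv'
      let w : EuclideanSpace ℝ (Fin d) × EuclideanSpace ℝ (Fin c) := L hy v
      have hw : w = (w.1, 0) := Prod.ext rfl hv'
      refine ⟨w.1, ?_⟩
      exact (congrArg A hw.symm).trans ((L hy).symm_apply_apply v)

variable (F : Foliation I M d c)

theorem finrank_tangent (x : M) : Module.finrank ℝ (F.tangent x) = d := by
  obtain ⟨s, -, hs⟩ := F.exists_contMDiffAt_frame x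
  rw [← hs.self_of_nhds.2, finrank_span_eq_card hs.self_of_nhds.1, Fintype.card_fin]

variable [RiemannianBundle (fun x : M ↦ TangentSpace I x)]

theorem tangentPart_mem (x : M) (v : TangentSpace I x) : F.tangentPart x v ∈ F.tangent x :=
  Submodule.starProjection_apply_mem _ _

theorem tangentPart_eq_self {x : M} {v : TangentSpace I x} (hv : v ∈ F.tangent x) :
    F.tangentPart x v = v :=
  Submodule.starProjection_eq_self_iff.2 hv

theorem normalPart_mem (x : M) (v : TangentSpace I x) : F.normalPart x v ∈ (F.tangent x)ᗮ :=
  Submodule.starProjection_apply_mem _ _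

theorem normalPart_eq_self {x : M} {v : TangentSpace I x} (hv : v ∈ (F.tangent x)ᗮ) :
    F.normalPart x v = v :=
  Submodule.starProjection_eq_self_iff.2 hv

theorem normalPart_eq_sub (x : M) (v : TangentSpace I x) :
    F.normalPart x v = v - F.tangentPart x v :=
  Submodule.starProjection_orthogonal_val v

theorem inner_tangentPart {x : M} {v w : TangentSpace I x} (hw : w ∈ F.tangent x) :
    inner ℝ w (F.tangentPart x v) = inner ℝ w v := by
  rw [tangentPart, ← Submodule.inner_starProjection_left_eq_right,
    Submodule.starProjection_eq_self_iff.2 hw]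

theorem inner_normalPart {x : M} {v w : TangentSpace I x} (hw : w ∈ (F.tangent x)ᗮ) :
    inner ℝ w (F.normalPart x v) = inner ℝ w v := by
  rw [normalPart, ← Submodule.inner_starProjection_left_eq_right,
    Submodule.starProjection_eq_self_iff.2 hw]

theorem tangentExtend_mem {x : M} (v : TangentSpace I x) (y : M) :
    F.tangentExtend v y ∈ F.tangent y := F.tangentPart_mem _ _

theorem normalExtend_mem {x : M} (v : TangentSpace I x) (y : M) :
    F.normalExtend v y ∈ (F.tangent y)ᗮ := F.normalPart_mem _ _

theorem tangentExtend_self {x : M} {v : TangentSpace I x} (hv : v ∈ F.tangent x) :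
    F.tangentExtend v x = v := by
  rw [tangentExtend, FiberBundle.extend_apply_self, F.tangentPart_eq_self hv]

theorem normalExtend_self {x : M} {v : TangentSpace I x} (hv : v ∈ (F.tangent x)ᗮ) :
    F.normalExtend v x = v := by
  rw [normalExtend, FiberBundle.extend_apply_self, F.normalPart_eq_self hv]

theorem frame_mem (x : M) (i : Fin (Module.finrank ℝ (F.tangent x))) :
    F.frame x i ∈ F.tangent x := Subtype.property _

theorem orthonormal_frame (x : M) : Orthonormal ℝ (F.frame x) :=
  (stdOrthonormalBasis ℝ (F.tangent x)).orthonormal.comp_linearIsometry (F.tangent x).subtypeₗᵢ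

theorem span_eq_tangent {x : M} {ι : Type*} [Fintype ι] {e : ι → TangentSpace I x}
    (he : Orthonormal ℝ e) (hF : ∀ i, e i ∈ F.tangent x) (hι : Fintype.card ι = d) :
    Submodule.span ℝ (range e) = F.tangent x := by
  refine Submodule.eq_of_le_of_finrank_eq (Submodule.span_le.2 (range_subset_iff.2 hF)) ?_
  rw [finrank_span_eq_card he.linearIndependent, hι, finrank_tangent]

variable [IsContMDiffRiemannianBundle I ∞ E (fun x : M ↦ TangentSpace I x)]

theorem exists_orthonormal_tangent_frame (x : M) :
    ∃ e : Fin d → Π x : M, TangentSpace I x, (∀ i, CMDiffAt ∞ (T% (e i)) x) ∧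
      ∀ᶠ y in 𝓝 x, Orthonormal ℝ (fun i ↦ e i y) ∧
        Submodule.span ℝ (range fun i ↦ e i y) = F.tangent y := by
  obtain ⟨s, hs, hF⟩ := F.exists_contMDiffAt_frame x
  obtain ⟨e, he, ho, hsp, -⟩ := exists_orthonormal_frame hs hF.self_of_nhds.1
  refine ⟨e, he, ?_⟩
  filter_upwards [hF, ho] with y h1 h2
  exact ⟨h2, (hsp y).trans h1.2⟩

theorem contMDiffAt_tangentPart {X : Π x : M, TangentSpace I x} {x : M}
    (hX : CMDiffAt ∞ (T% X) x) : CMDiffAt ∞ (T% (fun y ↦ F.tangentPart y (X y))) x := by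
  obtain ⟨e, he, hF⟩ := F.exists_orthonormal_tangent_frame x
  have : CMDiffAt ∞ (T% (fun y ↦ ∑ i, (pairing (e i) X • e i) y)) x :=
    ContMDiffAt.sum_section fun i _ ↦ (contMDiffAt_pairing (he i) hX).smul_section (he i)
  refine contMDiffAt_field_congr this ?_
  filter_upwards [hF] with y hy
  exact ((F.tangent y).starProjection_eq_sum_of_orthonormal hy.1 hy.2 (X y)).symm

theorem contMDiffAt_normalPart {X : Π x : M, TangentSpace I x} {x : M}
    (hX : CMDiffAt ∞ (T% X) x) : CMDiffAt ∞ (T% (fun y ↦ F.normalPart y (X y))) x := by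
  simp only [normalPart_eq_sub]
  exact hX.sub_section (F.contMDiffAt_tangentPart hX)

theorem contMDiffAt_tangentExtend {x : M} (v : TangentSpace I x) :
    CMDiffAt ∞ (T% (F.tangentExtend v)) x :=
  F.contMDiffAt_tangentPart (FiberBundle.contMDiffAt_extend I E v)

theorem contMDiffAt_normalExtend {x : M} (v : TangentSpace I x) :
    CMDiffAt ∞ (T% (F.normalExtend v)) x :=
  F.contMDiffAt_normalPart (FiberBundle.contMDiffAt_extend I E v)

theorem exists_orthonormal_tangent_extension {x : M} {m : ℕ} {v : Fin m → TangentSpace I x}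
    (hv : Orthonormal ℝ v) (hF : ∀ i, v i ∈ F.tangent x) :
    ∃ e : Fin m → Π x : M, TangentSpace I x, (∀ i, CMDiffAt ∞ (T% (e i)) x) ∧
      (∀ᶠ y in 𝓝 x, Orthonormal ℝ (fun i ↦ e i y)) ∧ (∀ i y, e i y ∈ F.tangent y) ∧
      ∀ i, e i x = v i := by
  have hx (i : Fin m) : F.tangentExtend (v i) x = v i := F.tangentExtend_self (hF i)
  obtain ⟨e, he, ho, hsp, hex⟩ := exists_orthonormal_frame
    (s := fun i ↦ F.tangentExtend (v i)) (fun i ↦ F.contMDiffAt_tangentExtend (v i))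
    (by simpa only [hx] using hv.linearIndependent)
  refine ⟨e, he, ho, fun i y ↦ ?_, fun i ↦ (hex (by simpa only [hx] using hv) i).trans (hx i)⟩
  have : e i y ∈ Submodule.span ℝ (range fun i ↦ e i y) := Submodule.subset_span ⟨i, rfl⟩
  rw [hsp] at this
  exact Submodule.span_le.2 (range_subset_iff.2 fun i ↦ F.tangentExtend_mem _ y) this

end Frames
end Foliation

theorem sum_inner_eq_of_orthonormal {V : Type*} [NormedAddCommGroup V] [InnerProductSpace ℝ V]
    {ι κ : Type*} [Fintype ι] [Fintype κ] {e : ι → V} {f : κ → V} (he : Orthonormal ℝ e)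
    (hf : Orthonormal ℝ f)
    (h : Submodule.span ℝ (range e) = Submodule.span ℝ (range f)) (A : V →L[ℝ] V) :
    ∑ i, inner ℝ (e i) (A (e i)) = ∑ j, inner ℝ (f j) (A (f j)) := by
  have : FiniteDimensional ℝ (Submodule.span ℝ (range e)) := .span_of_finite ℝ (finite_range e)
  have h1 (i : ι) : e i = ∑ j, inner ℝ (f j) (e i) • f j := by
    rw [← (Submodule.span ℝ (range e)).starProjection_eq_sum_of_orthonormal hf h.symm]
    exact (Submodule.starProjection_eq_self_iff.2 (Submodule.subset_span (mem_range_self i))).symm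
  have h2 (j : κ) : f j = ∑ i, inner ℝ (e i) (f j) • e i := by
    rw [← (Submodule.span ℝ (range e)).starProjection_eq_sum_of_orthonormal he rfl]
    exact (Submodule.starProjection_eq_self_iff.2
      (h.symm ▸ Submodule.subset_span (mem_range_self j) :
        f j ∈ Submodule.span ℝ (range e))).symm
  calc ∑ i, inner ℝ (e i) (A (e i))
      = ∑ i, ∑ j, inner ℝ (f j) (e i) * inner ℝ (f j) (A (e i)) := by
        refine Finset.sum_congr rfl fun i _ ↦ ?_
        exact (congrArg (fun w ↦ inner ℝ w (A (e i))) (h1 i)).trans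
          (by simp [sum_inner, real_inner_smul_left])
    _ = ∑ j, inner ℝ (f j) (A (f j)) := by
        rw [Finset.sum_comm]
        refine Finset.sum_congr rfl fun j _ ↦ ?_
        refine Eq.trans ?_ (congrArg (fun w ↦ inner ℝ (f j) (A w)) (h2 j)).symm
        simp [inner_sum, real_inner_smul_right, real_inner_comm]

theorem sum_inner_commutator_eq {V : Type*} [NormedAddCommGroup V] [InnerProductSpace ℝ V]
    {ι : Type*} [Fintype ι] {e : ι → V} (he : Orthonormal ℝ e) (U : Submodule ℝ V)
    [U.HasOrthogonalProjection] (hU : Submodule.span ℝ (range e) = U)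
    (D : V →L[ℝ] V) (a : ι → V) {v k : V} (hv : v ∈ Uᗮ) (hk : k ∈ U)
    (hsymm : ∀ i j, inner ℝ (e j) (D (e i)) = inner ℝ (e i) (D (e j)))
    (hanti : ∀ i j, inner ℝ (e j) (a i) = -inner ℝ (e i) (a j))
    (ha : ∀ i, ∀ u ∈ Uᗮ, inner ℝ u (a i) = -(inner ℝ u v * inner ℝ k (e i)))
    (hD : ∀ i, ∀ u ∈ Uᗮ, inner ℝ (e i) (D u) = inner ℝ u v * inner ℝ k (e i))
    (hDv : ∀ i, inner ℝ v (D (e i)) = 0) (hv1 : ‖v‖ = 1) :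
    ∑ i, (inner ℝ (a i) (D (e i)) + inner ℝ (e i) (D (a i - D (e i))))
      = -∑ i, ∑ j, inner ℝ (e j) (D (e i)) ^ 2 - ‖k‖ ^ 2 := by
  have hsum (w : V) : w = ∑ j, inner ℝ (e j) w • e j + Uᗮ.starProjection w := by
    rw [← U.starProjection_eq_sum_of_orthonormal he hU, U.starProjection_add_starProjection_orthogonal]
  have hn (w : V) : Uᗮ.starProjection w ∈ Uᗮ := Submodule.starProjection_apply_mem _ _
  have hnw (w u : V) (hu : u ∈ Uᗮ) : inner ℝ u (Uᗮ.starProjection w) = inner ℝ u w := by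
    rw [← Submodule.inner_starProjection_left_eq_right, Submodule.starProjection_eq_self_iff.2 hu]
  have haU (i : ι) : Uᗮ.starProjection (a i) = -(inner ℝ k (e i) • v) := by
    refine ext_inner_left ℝ fun w ↦ ?_
    rw [← Submodule.inner_starProjection_left_eq_right, ha i _ (hn w),
      Submodule.inner_starProjection_left_eq_right, Submodule.starProjection_eq_self_iff.2 hv,
      inner_neg_right, real_inner_smul_right]
    ring
  have h1 (i : ι) : inner ℝ (a i) (D (e i))
      = ∑ j, inner ℝ (e j) (a i) * inner ℝ (e j) (D (e i)) := by
    conv_lhs => rw [hsum (a i), haU]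
    rw [inner_add_left, sum_inner, inner_neg_left, real_inner_smul_left, hDv]
    simp [real_inner_smul_left]
  have hDsum (i : ι) (w : V) : inner ℝ (e i) (D w)
      = ∑ j, inner ℝ (e j) w * inner ℝ (e i) (D (e j))
        + inner ℝ w v * inner ℝ k (e i) := by
    conv_lhs => rw [hsum w]
    rw [map_add, inner_add_right, hD i _ (hn w), Submodule.inner_starProjection_left_eq_right,
      Submodule.starProjection_eq_self_iff.2 hv, map_sum, inner_sum]
    simp [real_inner_smul_right]
  have h2 (i : ι) : inner ℝ (e i) (D (a i - D (e i)))
      = ∑ j, inner ℝ (e j) (a i) * inner ℝ (e i) (D (e j)) - inner ℝ k (e i) ^ 2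
        - ∑ j, inner ℝ (e j) (D (e i)) ^ 2 := by
    rw [map_sub, inner_sub_right, hDsum i (a i), hDsum i (D (e i)), real_inner_comm v (D (e i)), hDv,
      real_inner_comm v (a i), ha i v hv, real_inner_self_eq_norm_sq, hv1]
    have : ∀ j, inner ℝ (e j) (D (e i)) * inner ℝ (e i) (D (e j)) = inner ℝ (e j) (D (e i)) ^ 2 :=
      fun j ↦ by rw [← hsymm i j]; ring
    simp only [this]
    ring
  have h3 : ∑ i, ∑ j, inner ℝ (e j) (a i) * inner ℝ (e j) (D (e i)) = 0 := by
    have : ∑ i, ∑ j, inner ℝ (e j) (a i) * inner ℝ (e j) (D (e i))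
        = -∑ i, ∑ j, inner ℝ (e j) (a i) * inner ℝ (e j) (D (e i)) := by
      conv_lhs => rw [Finset.sum_comm]
      simp only [← Finset.sum_neg_distrib]
      refine Finset.sum_congr rfl fun i _ ↦ Finset.sum_congr rfl fun j _ ↦ ?_
      rw [hanti j i, hsymm j i]
      ring
    linarith
  have h4 : ∑ i, inner ℝ k (e i) ^ 2 = ‖k‖ ^ 2 := by
    have hk' := U.starProjection_eq_sum_of_orthonormal he hU k
    rw [Submodule.starProjection_eq_self_iff.2 hk] at hk'
    rw [← real_inner_self_eq_norm_sq]
    refine Eq.trans ?_ (congrArg (fun w ↦ inner ℝ w k) hk').symm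
    simp only [sum_inner]
    refine Finset.sum_congr rfl fun i _ ↦ ?_
    rw [real_inner_smul_left, real_inner_comm k (e i)]
    ring
  have h5 (i : ι) : ∑ j, inner ℝ (e j) (a i) * inner ℝ (e i) (D (e j))
      = ∑ j, inner ℝ (e j) (a i) * inner ℝ (e j) (D (e i)) :=
    Finset.sum_congr rfl fun j _ ↦ by rw [hsymm i j]
  simp only [h1, h2, h5, Finset.sum_add_distrib, Finset.sum_sub_distrib, h3, h4]
  ring

theorem sq_sum_le_card_mul_sum_sum_sq {ι : Type*} [Fintype ι] (b : ι → ι → ℝ) :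
    (∑ i, b i i) ^ 2 ≤ Fintype.card ι * ∑ i, ∑ j, b i j ^ 2 := by
  refine (sq_sum_le_card_mul_sum_sq (s := Finset.univ) (f := fun i ↦ b i i)).trans ?_
  rw [Finset.card_univ]
  gcongr with i
  exact Finset.single_le_sum (f := fun j ↦ b i j ^ 2) (fun j _ ↦ sq_nonneg _) (Finset.mem_univ i)

namespace FoliatedManifold
variable {E : Type*} [NormedAddCommGroup E] [NormedSpace ℝ E]
  {H : Type*} [TopologicalSpace H] {I : ModelWithCorners ℝ E H}
  {M : Type*} [TopologicalSpace M] [ChartedSpace H M]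

theorem mdifferentiableAt_fun_sum {ι : Type*} {s : Finset ι} {f : ι → M → ℝ} {x : M}
    (hf : ∀ i ∈ s, MDiffAt (f i) x) :
    MDiffAt (fun y ↦ ∑ i ∈ s, f i y) x ∧
      ∀ v, d% (fun y ↦ ∑ i ∈ s, f i y) x v = ∑ i ∈ s, d% (f i) x v := by
  classical
  induction s using Finset.induction_on with
  | empty =>
    simp only [Finset.sum_empty, mvfderiv_const]
    exact ⟨mdifferentiableAt_const, fun v ↦ rfl⟩
  | insert a s ha ih =>
    obtain ⟨h1, h2⟩ := ih fun i hi ↦ hf i (Finset.mem_insert_of_mem hi)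
    have h3 := hf a (Finset.mem_insert_self a s)
    simp only [Finset.sum_insert ha]
    refine ⟨h3.add h1, fun v ↦ ?_⟩
    rw [← h2, show (fun y ↦ f a y + ∑ i ∈ s, f i y) = f a + fun y ↦ ∑ i ∈ s, f i y from rfl,
      mvfderiv_add h3 h1]
    rfl

end FoliatedManifold

namespace Foliation
variable {E : Type*} [NormedAddCommGroup E] [NormedSpace ℝ E] [FiniteDimensional ℝ E]
  {H : Type*} [TopologicalSpace H] {I : ModelWithCorners ℝ E H}
  {M : Type*} [TopologicalSpace M] [ChartedSpace H M] [IsManifold I ∞ M] {d c : ℕ}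
  [RiemannianBundle (fun x : M ↦ TangentSpace I x)]
  [IsContMDiffRiemannianBundle I ∞ E (fun x : M ↦ TangentSpace I x)] (F : Foliation I M d c)

variable {F} in
theorem inner_leviCivita_eq_neg {X Y : Π x : M, TangentSpace I x} {x : M}
    (hX : MDiffAt (T% X) x) (hY : MDiffAt (T% Y) x)
    (hXF : ∀ᶠ y in 𝓝 x, X y ∈ F.tangent y) (hYF : ∀ᶠ y in 𝓝 x, Y y ∈ (F.tangent y)ᗮ)
    (v : TangentSpace I x) :
    inner ℝ (Y x) (leviCivita I M X x v) = -inner ℝ (X x) (leviCivita I M Y x v) := by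
  have h : pairing X Y =ᶠ[𝓝 x] fun _ ↦ (0 : ℝ) := by
    filter_upwards [hXF, hYF] with y h1 h2
    exact Submodule.inner_right_of_mem_orthogonal h1 h2
  have := mvfderiv_pairing hX hY v
  rw [mvfderiv_congr h, mvfderiv_const, real_inner_comm] at this
  change (0 : ℝ) = _ at this
  linarith

theorem meanCurvature_mem (x : M) : F.meanCurvature x ∈ (F.tangent x)ᗮ :=
  Submodule.smul_mem _ _ (Submodule.sum_mem _ fun _ _ ↦ F.normalPart_mem _ _)

theorem inner_secondFundamentalForm {N : Π x : M, TangentSpace I x} {x : M}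
    (hN : MDiffAt (T% N) x) (hNF : ∀ᶠ y in 𝓝 x, N y ∈ (F.tangent y)ᗮ) (u : TangentSpace I x)
    {v : TangentSpace I x} (hv : v ∈ F.tangent x) :
    inner ℝ (N x) (F.secondFundamentalForm x u v) = -inner ℝ v (leviCivita I M N x u) := by
  rw [secondFundamentalForm, F.inner_normalPart hNF.self_of_nhds,
    inner_leviCivita_eq_neg ((F.contMDiffAt_tangentExtend v).mdifferentiableAt (by simp)) hN
      (Eventually.of_forall (F.tangentExtend_mem v)) hNF, F.tangentExtend_self hv]

theorem inner_meanCurvature {N : Π x : M, TangentSpace I x} {x : M}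
    (hN : MDiffAt (T% N) x) (hNF : ∀ᶠ y in 𝓝 x, N y ∈ (F.tangent y)ᗮ)
    {ι : Type*} [Fintype ι] {e : ι → TangentSpace I x} (he : Orthonormal ℝ e)
    (hspan : Submodule.span ℝ (range e) = F.tangent x) :
    d * inner ℝ (N x) (F.meanCurvature x) = -∑ i, inner ℝ (e i) (leviCivita I M N x (e i)) := by
  have h1 : ∑ i, inner ℝ (e i) (leviCivita I M N x (e i))
      = -inner ℝ (N x) (∑ i, F.secondFundamentalForm x (F.frame x i) (F.frame x i)) := by
    rw [sum_inner_eq_of_orthonormal he (F.orthonormal_frame x) (hspan.trans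
      (F.span_eq_tangent (F.orthonormal_frame x) (F.frame_mem x)
        (by simp [F.finrank_tangent])).symm), inner_sum, ← Finset.sum_neg_distrib]
    refine Finset.sum_congr rfl fun i _ ↦ ?_
    rw [F.inner_secondFundamentalForm hN hNF _ (F.frame_mem x i), neg_neg]
  rw [h1, neg_neg, meanCurvature, inner_smul_right]
  rcases Nat.eq_zero_or_pos d with rfl | hd
  · have : IsEmpty (Fin (Module.finrank ℝ (F.tangent x))) := by
      rw [F.finrank_tangent]; infer_instance
    simp
  · have : (d : ℝ) ≠ 0 := by positivity
    field_simp

theorem contMDiffAt_meanCurvature (x : M) : CMDiffAt ∞ (T% F.meanCurvature) x := by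
  obtain ⟨e, he, hF⟩ := F.exists_orthonormal_tangent_frame x
  have hs : CMDiffAt ∞ (T% fun y ↦ (d : ℝ)⁻¹ •
      ∑ i, F.normalPart y (nabla I (e i) (e i) y)) x :=
    ContMDiffAt.smul_section (f := fun _ ↦ (d : ℝ)⁻¹) contMDiffAt_const
      (ContMDiffAt.sum_section fun i _ ↦
        F.contMDiffAt_normalPart (contMDiffAt_nabla (he i) (he i)))
  refine contMDiffAt_field_congr hs ?_
  filter_upwards [eventually_all.2 fun i ↦ eventually_mdifferentiableAt (he i),
    hF.eventually_nhds] with y hd hF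
  have heF (i : Fin d) : ∀ᶠ z in 𝓝 y, e i z ∈ F.tangent z :=
    hF.mono fun z hz ↦ hz.2 ▸ Submodule.subset_span ⟨i, rfl⟩
  rcases Nat.eq_zero_or_pos d with rfl | hd0
  · simp [meanCurvature]
  have hd0' : (d : ℝ) ≠ 0 := by positivity
  rw [inv_smul_eq_iff₀ hd0']
  have hmem : (d : ℝ) • F.meanCurvature y - ∑ i, F.normalPart y (nabla I (e i) (e i) y)
      ∈ (F.tangent y)ᗮ :=
    Submodule.sub_mem _ (Submodule.smul_mem _ _ (F.meanCurvature_mem y))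
      (Submodule.sum_mem _ fun i _ ↦ F.normalPart_mem _ _)
  rw [eq_comm, ← sub_eq_zero, ← inner_self_eq_zero (𝕜 := ℝ)]
  set w := (d : ℝ) • F.meanCurvature y - ∑ i, F.normalPart y (nabla I (e i) (e i) y) with hw
  have hN := (F.contMDiffAt_normalExtend w).mdifferentiableAt (n := ∞) (by simp)
  have hNF := Eventually.of_forall (f := 𝓝 y) (F.normalExtend_mem w)
  have hNy := F.normalExtend_self hmem
  have key := F.inner_meanCurvature hN hNF hF.self_of_nhds.1 hF.self_of_nhds.2
  rw [hNy] at key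
  have h2 (i : Fin d) : inner ℝ w (F.normalPart y (nabla I (e i) (e i) y))
      = -inner ℝ (e i y) (leviCivita I M (F.normalExtend w) y (e i y)) := by
    rw [F.inner_normalPart hmem, nabla]
    have := inner_leviCivita_eq_neg (hd i) hN (heF i) hNF (e i y)
    rwa [hNy] at this
  conv_lhs => rw [hw, ← hw, inner_sub_right, inner_smul_right, inner_sum]
  simp only [h2, key]
  simp

end Foliation

namespace Foliation
variable {E : Type*} [NormedAddCommGroup E] [NormedSpace ℝ E] [FiniteDimensional ℝ E]
  {H : Type*} [TopologicalSpace H] {I : ModelWithCorners ℝ E H}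
  {M : Type*} [TopologicalSpace M] [ChartedSpace H M] [IsManifold I ∞ M] {d c : ℕ}
  [RiemannianBundle (fun x : M ↦ TangentSpace I x)]
  [IsContMDiffRiemannianBundle I ∞ E (fun x : M ↦ TangentSpace I x)]

theorem isTotallyUmbilical_of_dim_one (F : Foliation I M 1 c) : F.IsTotallyUmbilical := by
  intro x ξ _
  obtain ⟨w, -, hw⟩ := finrank_eq_one_iff'.1 (F.finrank_tangent x)
  have hmem (u : TangentSpace I x) : F.weingarten x ξ u ∈ F.tangent x :=
    Submodule.neg_mem _ (F.tangentPart_mem _ _)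
  obtain ⟨μ, hμ⟩ := hw ⟨_, hmem w⟩
  refine ⟨μ, fun u hu ↦ ?_⟩
  obtain ⟨a, ha⟩ := hw ⟨u, hu⟩
  have hμ' : μ • (w : TangentSpace I x) = F.weingarten x ξ w := congrArg Subtype.val hμ
  have ha' : a • (w : TangentSpace I x) = u := congrArg Subtype.val ha
  rw [← ha', smul_comm, hμ']
  simp [weingarten, tangentPart]

theorem inner_leviCivita_of_isTotallyUmbilical {F : Foliation I M d c}
    (hU : F.IsTotallyUmbilical) (hd : 0 < d) {W : Π x : M, TangentSpace I x} {x : M}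
    (hW : MDiffAt (T% W) x) (hWF : ∀ᶠ y in 𝓝 x, W y ∈ F.tangent y) {ξ u : TangentSpace I x}
    (hξ : ξ ∈ (F.tangent x)ᗮ) (hu : u ∈ F.tangent x) :
    inner ℝ ξ (leviCivita I M W x u) = inner ℝ u (W x) * inner ℝ ξ (F.meanCurvature x) := by
  obtain ⟨μ, hμ⟩ := hU x ξ hξ
  have hN := (F.contMDiffAt_normalExtend ξ).mdifferentiableAt (n := ∞) (by simp)
  have hNF := Eventually.of_forall (f := 𝓝 x) (F.normalExtend_mem ξ)
  have hNx := F.normalExtend_self hξ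
  have hμ' {u w : TangentSpace I x} (hu : u ∈ F.tangent x) (hw : w ∈ F.tangent x) :
      inner ℝ w (leviCivita I M (F.normalExtend ξ) x u) = -(μ * inner ℝ w u) := by
    have h := congrArg (fun z ↦ inner ℝ w z) (hμ u hu)
    simp only [weingarten, inner_neg_right, F.inner_tangentPart hw, real_inner_smul_right] at h
    linarith
  have hmean := F.inner_meanCurvature hN hNF (F.orthonormal_frame x)
    (F.span_eq_tangent (F.orthonormal_frame x) (F.frame_mem x) (by simp [F.finrank_tangent]))
  have hterm (i : Fin (Module.finrank ℝ (F.tangent x))) : inner ℝ (F.frame x i)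
      (leviCivita I M (F.normalExtend ξ) x (F.frame x i)) = -μ := by
    rw [hμ' (F.frame_mem x i) (F.frame_mem x i), real_inner_self_eq_norm_sq,
      (F.orthonormal_frame x).1 i]
    ring
  simp only [hterm, hNx, Finset.sum_const, Finset.card_univ, Fintype.card_fin, nsmul_eq_mul,
    F.finrank_tangent] at hmean
  have hd' : (d : ℝ) ≠ 0 := by positivity
  have hμe : inner ℝ ξ (F.meanCurvature x) = μ := mul_left_cancel₀ hd' (by linarith)
  have := inner_leviCivita_eq_neg hW hN hWF hNF u
  rw [hNx, hμ' hu hWF.self_of_nhds] at this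
  rw [this, hμe, real_inner_comm]
  ring

theorem IsOrthogonal.orthogonal_tangent {F : Foliation I M d c} {G : Foliation I M c d}
    (h : F.IsOrthogonal G) (x : M) : (G.tangent x)ᗮ = F.tangent x := by
  rw [h x, Submodule.orthogonal_orthogonal]

theorem le_inner_leviCivita_meanCurvature {F : Foliation I M d c} {G : Foliation I M c d}
    (hFG : F.IsOrthogonal G) (hU : G.IsTotallyUmbilical) (hc : 0 < c) {x : M}
    {v : TangentSpace I x} (hv : v ∈ G.tangent x) (hv1 : ‖v‖ = 1) :
    F.curvatureTrace x v - F.divergence G.meanCurvature x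
      + d * inner ℝ v (F.meanCurvature x) ^ 2 + ‖G.meanCurvature x‖ ^ 2
      ≤ d * inner ℝ v (leviCivita I M F.meanCurvature x v) := by
  have hsm {X : Π x : M, TangentSpace I x} (hX : CMDiffAt ∞ (T% X) x) : MDiffAt (T% X) x :=
    hX.mdifferentiableAt (by simp)
  obtain ⟨N', hN', hN'o, hN'G, hN'x⟩ := G.exists_orthonormal_tangent_extension (x := x)
    (v := fun _ : Fin 1 ↦ v) ⟨fun _ ↦ hv1, fun i j hij ↦ absurd (Subsingleton.elim i j) hij⟩
    (fun _ ↦ hv)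
  set N := N' 0
  have hN : CMDiffAt ∞ (T% N) x := hN' 0
  have hNx : N x = v := hN'x 0
  have hN1 : ∀ᶠ y in 𝓝 x, ‖N y‖ = 1 := hN'o.mono fun y hy ↦ hy.1 0
  have hNG : ∀ y, N y ∈ G.tangent y := hN'G 0
  have hNF : ∀ y, N y ∈ (F.tangent y)ᗮ := fun y ↦ hFG y ▸ hNG y
  obtain ⟨e, he, heo, heF, hex⟩ := F.exists_orthonormal_tangent_extension (x := x)
    (F.orthonormal_frame x) (F.frame_mem x)
  set k := G.meanCurvature with hk
  set h := F.meanCurvature with hh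
  have hkx : CMDiffAt ∞ (T% k) x := G.contMDiffAt_meanCurvature x
  have hhx : CMDiffAt ∞ (T% h) x := F.contMDiffAt_meanCurvature x
  have hkF (y : M) : k y ∈ F.tangent y := hFG.orthogonal_tangent y ▸ G.meanCurvature_mem y
  have hhF (y : M) : h y ∈ (F.tangent y)ᗮ := F.meanCurvature_mem y
  have heoF (y : M) (hy : Orthonormal ℝ (fun i ↦ e i y)) :
      Submodule.span ℝ (range fun i ↦ e i y) = F.tangent y :=
    F.span_eq_tangent hy (fun i ↦ heF i y) (by simp [F.finrank_tangent])
  have hmean {Z : Π x : M, TangentSpace I x} {y : M} (hZ : MDiffAt (T% Z) y)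
      (hZF : ∀ᶠ z in 𝓝 y, Z z ∈ (F.tangent z)ᗮ) (hy : Orthonormal ℝ (fun i ↦ e i y)) :
      ∑ i, inner ℝ (e i y) (leviCivita I M Z y (e i y)) = -(d * inner ℝ (Z y) (h y)) := by
    rw [F.inner_meanCurvature hZ hZF hy (heoF y hy), neg_neg]
  -- the derivative of the trace of `∇N` along `N`
  have hS : (fun y ↦ ∑ i, pairing (e i) (nabla I (e i) N) y)
      =ᶠ[𝓝 x] ((fun _ ↦ -(d : ℝ)) * pairing N h) := by
    filter_upwards [eventually_mdifferentiableAt hN, heo] with y h1 h2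
    exact (hmean h1 (Eventually.of_forall hNF) h2).trans (neg_mul _ _).symm
  have hS' := congrArg (fun L ↦ L v) (mvfderiv_congr hS)
  have heN (i) : MDiffAt (T% (nabla I (e i) N)) x := hsm (contMDiffAt_nabla (he i) hN)
  beta_reduce at hS'
  rw [(mdifferentiableAt_fun_sum fun i _ ↦ mdifferentiableAt_pairing (hsm (he i)) (heN i)).2,
    mvfderiv_mul mdifferentiableAt_const (mdifferentiableAt_pairing (hsm hN) (hsm hhx)),
    mvfderiv_const] at hS'
  simp only [mvfderiv_pairing (hsm (he _)) (heN _)] at hS'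
  -- commute the derivatives
  have hR (i) : leviCivita I M (nabla I (e i) N) x v = curvatureField I N (e i) N x
      + leviCivita I M (nabla I N N) x (e i x)
      + leviCivita I M N x (leviCivita I M (e i) x v - leviCivita I M N x (e i x)) := by
    rw [← hNx, nabla_sub_nabla (hsm hN) (hsm (he i))]
    simp only [curvatureField, nabla]
    module
  have hcurv (i) : inner ℝ (e i x) (curvatureField I N (e i) N x)
      = -curvature I x v (F.frame x i) (F.frame x i) v := by
    have hs (w : TangentSpace I x) := FiberBundle.contMDiffAt_extend (k := ∞) I E w
    rw [curvature, curvatureField_congr (hsm (hs v)) (hsm hN) (hsm (hs (F.frame x i)))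
      (hsm (he i)) (hs (F.frame x i)) (by simp [hNx]) (by simp [hex]), ← hNx,
      inner_curvatureField_swap hN (he i) (hs _) hN]
    simp [hex]
  -- `∇_N N` is the sum of the mean curvature vector of `G` and a field tangent to `G`
  set Y : Π x : M, TangentSpace I x := fun y ↦ nabla I N N y - k y with hY
  have hYx : CMDiffAt ∞ (T% Y) x := (contMDiffAt_nabla hN hN).sub_section hkx
  have humb {W : Π x : M, TangentSpace I x} {y : M} (hW : MDiffAt (T% W) y)
      (hWG : ∀ᶠ z in 𝓝 y, W z ∈ G.tangent z) {ξ u : TangentSpace I y}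
      (hξ : ξ ∈ F.tangent y) (hu : u ∈ G.tangent y) :
      inner ℝ ξ (leviCivita I M W y u) = inner ℝ u (W y) * inner ℝ ξ (k y) :=
    inner_leviCivita_of_isTotallyUmbilical hU hc hW hWG
      (by rwa [hFG.orthogonal_tangent y]) hu
  have hYF : ∀ᶠ y in 𝓝 x, Y y ∈ (F.tangent y)ᗮ := by
    filter_upwards [hN1, eventually_mdifferentiableAt hN] with y h1 h2
    rw [Submodule.mem_orthogonal]
    intro u hu
    rw [hY, inner_sub_right, nabla, humb h2 (Eventually.of_forall hNG) hu (hNG y),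
      real_inner_self_eq_norm_sq, h1]
    ring
  have hNN (i) : leviCivita I M (nabla I N N) x (e i x)
      = leviCivita I M k x (e i x) + leviCivita I M Y x (e i x) := by
    have : nabla I N N = k + Y := by ext1 y; simp [hY]
    rw [this, show leviCivita I M (k + Y) x = _ from
      (leviCivita I M).isCovariantDerivativeOnUniv.add (hsm hkx) (hsm hYx)]
    rfl
  have hdiv : ∑ i, inner ℝ (e i x) (leviCivita I M k x (e i x)) = F.divergence k x := by
    simp only [hex, divergence]
  have hYsum := hmean (hsm hYx) hYF heo.self_of_nhds
  have hYh : inner ℝ (Y x) (h x) = inner ℝ (h x) (leviCivita I M N x v) := by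
    rw [hY, inner_sub_left, Submodule.inner_right_of_mem_orthogonal (hkF x) (hhF x), sub_zero,
      nabla, hNx, real_inner_comm]
  -- the algebraic terms
  have halg := sum_inner_commutator_eq heo.self_of_nhds (F.tangent x) (heoF x heo.self_of_nhds)
    (leviCivita I M N x) (fun i ↦ leviCivita I M (e i) x v) (hFG x ▸ hv) (hkF x)
    (fun i j ↦ by
      have h1 := inner_leviCivita_eq_neg (hsm (he j)) (hsm hN) (Eventually.of_forall (heF j))
        (Eventually.of_forall hNF) (e i x)
      have h2 := inner_leviCivita_eq_neg (hsm (he i)) (hsm hN) (Eventually.of_forall (heF i))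
        (Eventually.of_forall hNF) (e j x)
      have h3 := mlieBracket_mem_tangent (he i) (he j) (Eventually.of_forall (heF i))
        (Eventually.of_forall (heF j))
      rw [← nabla_sub_nabla (hsm (he i)) (hsm (he j))] at h3
      have h4 := Submodule.inner_left_of_mem_orthogonal h3 (hNF x)
      rw [inner_sub_right] at h4
      linarith)
    (fun i j ↦ by
      have h1 : pairing (e i) (e j) =ᶠ[𝓝 x] fun _ ↦ if i = j then (1 : ℝ) else 0 := by
        filter_upwards [heo] with y hy
        exact orthonormal_iff_ite.1 hy i j
      have h2 := mvfderiv_pairing (hsm (he i)) (hsm (he j)) v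
      rw [mvfderiv_congr h1, mvfderiv_const, real_inner_comm] at h2
      change (0 : ℝ) = _ at h2
      linarith)
    (fun i u hu ↦ by
      have hu' : u ∈ G.tangent x := hFG x ▸ hu
      have h1 := inner_leviCivita_eq_neg (hsm (he i))
        (hsm (G.contMDiffAt_tangentExtend u)) (Eventually.of_forall (heF i))
        (Eventually.of_forall fun y ↦ hFG y ▸ G.tangentExtend_mem u y) v
      rw [G.tangentExtend_self hu', humb (hsm (G.contMDiffAt_tangentExtend u))
        (Eventually.of_forall (G.tangentExtend_mem u)) (heF i x) hv, G.tangentExtend_self hu'] at h1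
      rw [h1, real_inner_comm v u, real_inner_comm (k x)])
    (fun i u hu ↦ by
      rw [humb (hsm hN) (Eventually.of_forall hNG) (heF i x) (hFG x ▸ hu), hNx,
        real_inner_comm (k x)])
    (fun i ↦ by
      have h1 : pairing N N =ᶠ[𝓝 x] fun _ ↦ (1 : ℝ) := by
        filter_upwards [hN1] with y hy
        rw [pairing, real_inner_self_eq_norm_sq, hy, one_pow]
      have h2 := mvfderiv_pairing (hsm hN) (hsm hN) (e i x)
      rw [mvfderiv_congr h1, mvfderiv_const, real_inner_comm, hNx] at h2
      change (0 : ℝ) = _ at h2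
      linarith) hv1
  have htrace : inner ℝ v (h x) * d
      = -∑ i, inner ℝ (e i x) (leviCivita I M N x (e i x)) := by
    rw [hmean (hsm hN) (Eventually.of_forall hNF) heo.self_of_nhds, hNx]
    ring
  have hcs := sq_sum_le_card_mul_sum_sum_sq
    fun i j ↦ inner ℝ (e j x) (leviCivita I M N x (e i x))
  have hcard : (Fintype.card (Fin (Module.finrank ℝ (F.tangent x))) : ℝ) = d := by
    rw [Fintype.card_fin, F.finrank_tangent]
  rw [hcard] at hcs
  set Q := ∑ i, ∑ j, inner ℝ (e j x) (leviCivita I M N x (e i x)) ^ 2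
  have hQ : d * inner ℝ v (h x) ^ 2 ≤ Q := by
    rcases Nat.eq_zero_or_pos d with hd | hd
    · have : (d : ℝ) = 0 := by exact_mod_cast hd
      rw [this, zero_mul]
      exact Finset.sum_nonneg fun i _ ↦ Finset.sum_nonneg fun j _ ↦ sq_nonneg _
    · have hd' : (0 : ℝ) < d := by exact_mod_cast hd
      have : (∑ i, inner ℝ (e i x) (leviCivita I M N x (e i x))) ^ 2
          = d * (d * inner ℝ v (h x) ^ 2) := by
        rw [← neg_sq, ← htrace]; ring
      rw [this] at hcs
      exact le_of_mul_le_mul_left hcs hd'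
  have hsum : ∑ i, (inner ℝ (leviCivita I M (e i) x v) (nabla I (e i) N x)
        + inner ℝ (e i x) (leviCivita I M (nabla I (e i) N) x v))
      = -F.curvatureTrace x v + F.divergence k x - d * inner ℝ (h x) (leviCivita I M N x v)
        - Q - ‖k x‖ ^ 2 := by
    have hterm (i) : inner ℝ (leviCivita I M (e i) x v) (nabla I (e i) N x)
          + inner ℝ (e i x) (leviCivita I M (nabla I (e i) N) x v)
        = -curvature I x v (F.frame x i) (F.frame x i) v
          + inner ℝ (e i x) (leviCivita I M k x (e i x))
          + inner ℝ (e i x) (leviCivita I M Y x (e i x))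
          + (inner ℝ (leviCivita I M (e i) x v) (leviCivita I M N x (e i x))
            + inner ℝ (e i x) (leviCivita I M N x
              (leviCivita I M (e i) x v - leviCivita I M N x (e i x)))) := by
      rw [hR, inner_add_right, inner_add_right, hcurv, hNN, inner_add_right, nabla]
      ring
    simp only [hterm, Finset.sum_add_distrib, Finset.sum_neg_distrib] at halg ⊢
    rw [hdiv, hYsum, hYh, curvatureTrace]
    linarith
  rw [hsum] at hS'
  have hprod := mvfderiv_pairing (hsm hN) (hsm hhx) v
  rw [hNx] at hprod
  simp only [smul_zero, add_zero, smul_apply, smul_eq_mul, hprod] at hS'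
  rw [real_inner_comm] at hS'
  linarith
end Foliation

section IntegralCurves
open scoped ENNReal

variable {E : Type*} [NormedAddCommGroup E] [NormedSpace ℝ E]
  {H : Type*} [TopologicalSpace H] {I : ModelWithCorners ℝ E H}

section Topological

variable {M : Type*} [TopologicalSpace M] [ChartedSpace H M] [IsManifold I 1 M]
  {v : Π x : M, TangentSpace I x} {γ η : ℝ → M} {t₀ : ℝ}

theorem eventually_continuousAt_tangentCoordChange (hv : CMDiff 1 (T% v)) (x : M) :
    ∀ᶠ y in 𝓝 x, ContinuousAt (fun y ↦ tangentCoordChange I y x y (v y)) y := by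
  have h := (contMDiffAt_section (F := E) (E := TangentSpace I) x).1 (hv x)
  exact ((contMDiffAt_iff_contMDiffAt_nhds (by simp)).1 h).mono fun y hy ↦ hy.continuousAt

theorem IsMIntegralCurveAt.contMDiffAt [BoundarylessManifold I M] (hv : CMDiff 1 (T% v))
    (hγ : IsMIntegralCurveAt γ v t₀) : ContMDiffAt 𝓘(ℝ) I 1 γ t₀ := by
  rw [contMDiffAt_iff_target]
  refine ⟨hγ.continuousAt, ?_⟩
  rw [contMDiffAt_iff_contDiffAt, contDiffAt_one_iff]
  obtain ⟨s, hs, hγs⟩ := isMIntegralCurveAt_iff.1 hγ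
  have h := (hγ.eventually_hasDerivAt.and (hγ.continuousAt.eventually
    (eventually_continuousAt_tangentCoordChange hv (γ t₀)))).and
    (eventually_mem_nhds_iff.2 hs)
  refine ⟨_, _, h, ?_, fun t ht ↦ ht.1.1.hasFDerivAt⟩
  intro t ht
  have h1 : ContinuousAt γ t := hγs.continuousOn.continuousAt ht.2
  have h2 := ContinuousAt.comp (f := γ) (g := fun y ↦ tangentCoordChange I y (γ t₀) y (v y)) ht.1.2 h1
  exact ((ContinuousLinearMap.smulRightL ℝ ℝ E (1 : ℝ →L[ℝ] ℝ)).continuous.continuousAt.comp h2).continuousWithinAt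

theorem hasMFDerivAt_piecewise (hv : CMDiff 1 (T% v)) {a : ℝ} (ha : a < t₀)
    (hγ : IsMIntegralCurveOn γ v (Ioo a t₀)) (hη : IsMIntegralCurveAt η v t₀)
    (hlim : Tendsto γ (𝓝[<] t₀) (𝓝 (η t₀))) :
    HasMFDerivAt% ((Iio t₀).piecewise γ η) t₀ ((1 : ℝ →L[ℝ] ℝ).smulRight (v (η t₀))) := by
  classical
  set ζ := (Iio t₀).piecewise γ η with hζ
  have hζ0 : ζ t₀ = η t₀ := piecewise_eq_of_notMem _ _ _ (by simp)
  have hζγ : EqOn ζ γ (Iio t₀) := piecewise_eqOn _ _ _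
  have hζη : EqOn ζ η (Ici t₀) := fun t ht ↦ piecewise_eq_of_notMem _ _ _ (by simpa using ht)
  have hleft : Tendsto ζ (𝓝[<] t₀) (𝓝 (ζ t₀)) := by
    rw [hζ0]
    exact hlim.congr' (eventually_mem_nhdsWithin.mono fun t ht ↦ (hζγ ht).symm)
  have hcont : ContinuousAt ζ t₀ := by
    rw [continuousAt_iff_continuous_left'_right']
    refine ⟨hleft, ?_⟩
    exact hη.continuousAt.continuousWithinAt.congr (fun t ht ↦ hζη (mem_Ici.2 (le_of_lt ht))) hζ0
  have hζon : IsMIntegralCurveOn ζ v (Ioo a t₀) := by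
    intro t ht
    rw [hζγ ht.2]
    exact (hγ t ht).congr_of_eventuallyEq (eventually_mem_nhdsWithin.mono fun s hs ↦ hζγ hs.2)
      (hζγ ht.2)
  have hself (y : M) : tangentCoordChange I y y y (v y) = v y :=
    tangentCoordChange_self (mem_extChartAt_source y)
  set f := extChartAt I (ζ t₀) ∘ ζ with hf
  set g := fun y ↦ tangentCoordChange I y (ζ t₀) y (v y) with hg
  set w : E := v (η t₀) with hw
  have hg0 : g (ζ t₀) = w := by
    rw [hg, hζ0]
    exact hself (η t₀)
  obtain ⟨b, hb, hsrc⟩ : ∃ b < t₀, ∀ t ∈ Ioo b t₀,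
      ζ t ∈ (extChartAt I (ζ t₀)).source ∧ t ∈ Ioo a t₀ := by
    have h := (hleft.eventually (extChartAt_source_mem_nhds (I := I) (ζ t₀))).and (Ioo_mem_nhdsLT ha)
    obtain ⟨b, hb, h⟩ := (mem_nhdsLT_iff_exists_Ioo_subset).1 h
    exact ⟨b, hb, h⟩
  have hder : ∀ t ∈ Ioo b t₀, HasDerivAt f (g (ζ t)) t := fun t ht ↦
    (hζon.hasDerivWithinAt (hsrc t ht).2 (hsrc t ht).1).hasDerivAt
      (isOpen_Ioo.mem_nhds (hsrc t ht).2)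
  have hmem : Ioo b t₀ ∈ 𝓝[<] t₀ := Ioo_mem_nhdsLT hb
  have hfc : ContinuousAt f t₀ := (continuousAt_extChartAt (ζ t₀)).comp hcont
  have h1 : HasDerivWithinAt f w (Iic t₀) t₀ := by
    refine hasDerivWithinAt_Iic_of_tendsto_deriv (s := Ioo b t₀)
      (fun t ht ↦ (hder t ht).differentiableAt.differentiableWithinAt)
      hfc.continuousWithinAt hmem ?_
    rw [← hg0]
    refine Tendsto.congr' (f₁ := fun t ↦ g (ζ t)) (eventually_of_mem hmem fun t ht ↦ (hder t ht).deriv.symm) ?_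
    exact (eventually_continuousAt_tangentCoordChange hv (ζ t₀)).self_of_nhds.tendsto.comp hleft
  have h2 : HasDerivWithinAt f w (Ici t₀) t₀ := by
    have h := hη.eventually_hasDerivAt.self_of_nhds
    refine (h.congr_deriv (hself (η t₀))).hasDerivWithinAt.congr (fun t ht ↦ ?_) ?_
    · rw [hf, Function.comp, hζη ht, hζ0]; rfl
    · rw [hf, Function.comp, hζ0]; rfl
  have h3 := h1.union h2
  rw [Iic_union_Ici, hasDerivWithinAt_univ] at h3
  refine ⟨hcont, ?_⟩
  simp only [mfld_simps]
  exact h3.hasFDerivAt.hasFDerivWithinAt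

end Topological

section Riemannian

variable {M : Type*} [EMetricSpace M] [ChartedSpace H M] [IsManifold I ∞ M]
  [RiemannianBundle (fun x : M ↦ TangentSpace I x)] [IsRiemannianManifold I M]
  {v : Π x : M, TangentSpace I x} {γ : ℝ → M}

theorem IsMIntegralCurveOn.edist_le [BoundarylessManifold I M] (hv : CMDiff 1 (T% v))
    (hv1 : ∀ x, ‖v x‖ ≤ 1) {a b : ℝ} (hγ : IsMIntegralCurveOn γ v (Ioo a b)) {s t : ℝ}
    (hs : s ∈ Ioo a b) (ht : t ∈ Ioo a b) (hst : s ≤ t) :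
    edist (γ s) (γ t) ≤ edist s t := by
  have hat (r : ℝ) (hr : r ∈ Icc s t) : IsMIntegralCurveAt γ v r :=
    hγ.isMIntegralCurveAt (Ioo_mem_nhds (hs.1.trans_le hr.1) (hr.2.trans_lt ht.2))
  rw [IsRiemannianManifold.out (I := I)]
  refine (Manifold.riemannianEDist_le_pathELength
    (fun r hr ↦ ((hat r hr).contMDiffAt hv).contMDiffWithinAt) rfl rfl hst).trans ?_
  rw [Manifold.pathELength_eq_lintegral_mfderiv_Icc]
  calc ∫⁻ r in Icc s t, ‖mfderiv% γ r 1‖ₑ ≤ ∫⁻ r in Icc s t, 1 := by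
        refine MeasureTheory.setLIntegral_mono measurable_const fun r hr ↦ ?_
        rw [(hat r hr).hasMFDerivAt.mfderiv]
        have : (ContinuousLinearMap.smulRight (1 : ℝ →L[ℝ] ℝ) (v (γ r))) 1 = v (γ r) := by simp
        refine le_trans (le_of_eq (congrArg _ this)) ?_
        rw [← ofReal_norm]
        exact ENNReal.ofReal_le_one.2 (hv1 _)
    _ = edist s t := by
        rw [MeasureTheory.setLIntegral_one, Real.volume_Icc, edist_comm, edist_dist,
          Real.dist_eq, abs_of_nonneg (sub_nonneg.2 hst)]

theorem IsMIntegralCurveOn.exists_tendsto_nhdsLT [CompleteSpace M] [BoundarylessManifold I M]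
    (hv : CMDiff 1 (T% v)) (hv1 : ∀ x, ‖v x‖ ≤ 1) {a b : ℝ} (hab : a < b)
    (hγ : IsMIntegralCurveOn γ v (Ioo a b)) : ∃ y, Tendsto γ (𝓝[<] b) (𝓝 y) := by
  have hL : LipschitzOnWith 1 γ (Ioo a b) := by
    intro s hs t ht
    rw [ENNReal.coe_one, one_mul]
    rcases le_total s t with h | h
    · exact hγ.edist_le hv hv1 hs ht h
    · rw [edist_comm, edist_comm s]
      exact hγ.edist_le hv hv1 ht hs h
  have hne : (𝓝[Ioo a b] b).NeBot := by rw [nhdsWithin_Ioo_eq_nhdsLT hab]; infer_instance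
  have hc : Cauchy (map γ (𝓝[Ioo a b] b)) := by
    refine ⟨hne.map _, ?_⟩
    rw [prod_map_map_eq]
    refine Tendsto.mono_left hL.uniformContinuousOn ?_
    rw [le_inf_iff]
    refine ⟨(cauchy_nhds.mono nhdsWithin_le_nhds).2, ?_⟩
    rw [le_principal_iff]
    exact prod_mem_prod self_mem_nhdsWithin self_mem_nhdsWithin
  obtain ⟨y, hy⟩ := CompleteSpace.complete hc
  exact ⟨y, by rwa [nhdsWithin_Ioo_eq_nhdsLT hab] at hy⟩

/-- A bounded field on a complete manifold has integral curves defined for all positive times. -/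
theorem exists_isMIntegralCurveOn_Ioo_of_norm_le [CompleteSpace E] [CompleteSpace M]
    [BoundarylessManifold I M] (hv : CMDiff 1 (T% v)) (hv1 : ∀ x, ‖v x‖ ≤ 1) (x : M) :
    ∃ δ > 0, ∀ a : ℝ, ∃ γ : ℝ → M, γ 0 = x ∧ IsMIntegralCurveOn γ v (Ioo (-δ) a) := by
  classical
  obtain ⟨γ₀, h0, hγ₀⟩ := exists_isMIntegralCurveAt_of_contMDiffAt_boundaryless 0 (hv x)
  obtain ⟨δ, hδ, hγ₀⟩ := isMIntegralCurveAt_iff'.1 hγ₀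
  rw [Real.ball_eq_Ioo, zero_sub, zero_add] at hγ₀
  refine ⟨δ, hδ, ?_⟩
  set S := {a : ℝ | ∃ γ : ℝ → M, γ 0 = x ∧ IsMIntegralCurveOn γ v (Ioo (-δ) a)} with hS
  by_contra! ⟨a, ha⟩
  have hδS : δ ∈ S := ⟨γ₀, h0, hγ₀⟩
  have hbdd : BddAbove S := ⟨a, fun b ⟨γ, hγ0, hγ⟩ ↦ not_lt.1 fun hab ↦
    ha γ hγ0 (hγ.mono (Ioo_subset_Ioo_right hab.le))⟩
  set s := sSup S with hs
  have hδs : δ ≤ s := le_csSup hbdd hδS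
  have hex (t : ℝ) : ∃ c, ∃ γ : ℝ → M, t < s → t < c ∧ 0 < c ∧ c ≤ s ∧ γ 0 = x ∧
      IsMIntegralCurveOn γ v (Ioo (-δ) c) := by
    by_cases ht : t < s
    · obtain ⟨c, ⟨γ, hγ⟩, hc⟩ := exists_lt_of_lt_csSup ⟨δ, hδS⟩ (max_lt ht (hδ.trans_le hδs))
      exact ⟨c, γ, fun _ ↦ ⟨(le_max_left _ _).trans_lt hc, (le_max_right _ _).trans_lt hc,
        le_csSup hbdd ⟨γ, hγ⟩, hγ⟩⟩
    · exact ⟨0, γ₀, fun h ↦ absurd h ht⟩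
  choose c Γ hΓ using hex
  have heq {t t' : ℝ} (ht : t < s) (ht' : t' ∈ Ioo (-δ) (c t)) : Γ t' t' = Γ t t' := by
    obtain ⟨h1, h2, h3, h4, h5⟩ := hΓ t ht
    obtain ⟨h1', h2', -, h4', h5'⟩ := hΓ t' (ht'.2.trans_le h3)
    refine isMIntegralCurveOn_Ioo_eqOn_of_contMDiff_boundaryless (a := -δ) (b := min (c t) (c t'))
      (t₀ := 0) ⟨by linarith, lt_min h2 h2'⟩ hv (h5'.mono (Ioo_subset_Ioo_right (min_le_right _ _)))
      (h5.mono (Ioo_subset_Ioo_right (min_le_left _ _))) (h4'.trans h4.symm) ⟨ht'.1, lt_min ht'.2 h1'⟩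
  set ζ : ℝ → M := fun t ↦ Γ t t with hζ
  have hζγ : IsMIntegralCurveOn ζ v (Ioo (-δ) s) := by
    rw [isMIntegralCurveOn_iff_isMIntegralCurveAt isOpen_Ioo]
    intro t ht
    obtain ⟨h1, -, -, -, h5⟩ := hΓ t ht.2
    refine IsMIntegralCurveOn.isMIntegralCurveAt (s := Ioo (-δ) (c t)) (fun t' ht' ↦ ?_)
      (Ioo_mem_nhds ht.1 h1)
    have := (h5 t' ht').congr_of_eventuallyEq
      (f₁ := ζ) (eventually_mem_nhdsWithin.mono fun r hr ↦ heq ht.2 hr) (heq ht.2 ht')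
    rwa [← heq ht.2 ht'] at this
  obtain ⟨y, hy⟩ := hζγ.exists_tendsto_nhdsLT hv hv1 (by linarith)
  obtain ⟨η, hη0, hη⟩ := exists_isMIntegralCurveAt_of_contMDiffAt_boundaryless s (hv y)
  obtain ⟨ε, hε, hη'⟩ := isMIntegralCurveAt_iff'.1 hη
  rw [Real.ball_eq_Ioo] at hη'
  have hglue := hasMFDerivAt_piecewise hv (by linarith) hζγ hη (hη0 ▸ hy)
  have hmem : s + ε ∈ S := by
    refine ⟨(Iio s).piecewise ζ η, ?_, ?_⟩
    · rw [piecewise_eq_of_mem _ _ _ (show (0 : ℝ) ∈ Iio s from hδ.trans_le hδs)]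
      exact (hΓ 0 (hδ.trans_le hδs)).2.2.2.1
    · intro t ht
      refine HasMFDerivAt.hasMFDerivWithinAt ?_
      rcases lt_trichotomy t s with h | rfl | h
      · have hev : (Iio s).piecewise ζ η =ᶠ[𝓝 t] ζ :=
          eventually_of_mem (Iio_mem_nhds h) fun r hr ↦ piecewise_eq_of_mem _ _ _ hr
        rw [hev.self_of_nhds]
        exact ((hζγ t ⟨ht.1, h⟩).hasMFDerivAt (Ioo_mem_nhds ht.1 h)).congr_of_eventuallyEq hev
      · rw [piecewise_eq_of_notMem _ _ _ (by simp)]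
        exact hglue
      · have hev : (Iio s).piecewise ζ η =ᶠ[𝓝 t] η :=
          eventually_of_mem (Ioi_mem_nhds h) fun r hr ↦ piecewise_eq_of_notMem _ _ _
            (by simpa using le_of_lt hr)
        rw [hev.self_of_nhds]
        have ht' : t ∈ Ioo (s - ε) (s + ε) := ⟨by linarith, ht.2⟩
        exact ((hη' t ht').hasMFDerivAt (Ioo_mem_nhds ht'.1 ht'.2)).congr_of_eventuallyEq hev
  linarith [le_csSup hbdd hmem]

end Riemannian

end IntegralCurves

theorem mul_le_one_of_sq_le_deriv {z z' : ℝ → ℝ} {T : ℝ} (hT : 0 ≤ T) (h0 : 0 < z 0)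
    (hz : ∀ t ∈ Icc 0 T, HasDerivAt z (z' t) t) (h : ∀ t ∈ Icc 0 T, z t ^ 2 ≤ z' t) :
    T * z 0 ≤ 1 := by
  have hmono : MonotoneOn z (Icc 0 T) := by
    refine monotoneOn_of_deriv_nonneg (convex_Icc 0 T)
      (fun t ht ↦ (hz t ht).continuousAt.continuousWithinAt)
      (fun t ht ↦ (hz t (interior_subset ht)).differentiableAt.differentiableWithinAt) fun t ht ↦ ?_
    rw [(hz t (interior_subset ht)).deriv]
    exact (sq_nonneg _).trans (h t (interior_subset ht))
  have hpos (t : ℝ) (ht : t ∈ Icc 0 T) : 0 < z t :=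
    h0.trans_le (hmono ⟨le_rfl, hT⟩ ht ht.1)
  have hd (t : ℝ) (ht : t ∈ Icc 0 T) : HasDerivAt (fun t ↦ -(z t)⁻¹ - t) (z' t / z t ^ 2 - 1) t := by
    have := ((hz t ht).inv (hpos t ht).ne').neg.sub (hasDerivAt_id t)
    rwa [neg_div, neg_neg] at this
  have hmono' : MonotoneOn (fun t ↦ -(z t)⁻¹ - t) (Icc 0 T) := by
    refine monotoneOn_of_deriv_nonneg (convex_Icc 0 T)
      (fun t ht ↦ (hd t ht).continuousAt.continuousWithinAt)
      (fun t ht ↦ (hd t (interior_subset ht)).differentiableAt.differentiableWithinAt) fun t ht ↦ ?_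
    rw [(hd t (interior_subset ht)).deriv, sub_nonneg,
      one_le_div (pow_pos (hpos t (interior_subset ht)) 2)]
    exact h t (interior_subset ht)
  have h1 := hmono' ⟨le_rfl, hT⟩ ⟨hT, le_rfl⟩ hT
  have h2 := inv_pos.2 (hpos T ⟨hT, le_rfl⟩)
  have h3 : T ≤ (z 0)⁻¹ := by simp only [sub_zero] at h1; linarith
  calc T * z 0 ≤ (z 0)⁻¹ * z 0 := mul_le_mul_of_nonneg_right h3 h0.le
    _ = 1 := inv_mul_cancel₀ h0.ne'

theorem HasMFDerivAt.hasDerivAt_comp {E : Type*} [NormedAddCommGroup E] [NormedSpace ℝ E]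
    {H : Type*} [TopologicalSpace H] {I : ModelWithCorners ℝ E H}
    {M : Type*} [TopologicalSpace M] [ChartedSpace H M] {γ : ℝ → M} {t : ℝ}
    {w : TangentSpace I (γ t)} {f : M → ℝ} (hf : MDiffAt f (γ t))
    (hγ : HasMFDerivAt 𝓘(ℝ, ℝ) I γ t ((1 : ℝ →L[ℝ] ℝ).smulRight w)) :
    HasDerivAt (f ∘ γ) (d% f (γ t) w) t := by
  have h1 : HasFDerivAt (f ∘ γ) (((d% f (γ t) w) • (1 : ℝ →L[ℝ] ℝ))) t := by
    refine hasMFDerivAt_iff_hasFDerivAt.1 ((hf.hasMFDerivAt.comp t hγ).congr_mfderiv ?_)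
    refine ContinuousLinearMap.ext fun (r : ℝ) ↦ ?_
    refine (map_smul (mfderiv I 𝓘(ℝ, ℝ) f (γ t)) r w).trans ?_
    exact mul_comm r (d% f (γ t) w)
  simpa using h1.hasDerivAt

namespace Foliation
variable {E : Type*} [NormedAddCommGroup E] [NormedSpace ℝ E] [FiniteDimensional ℝ E]
  {H : Type*} [TopologicalSpace H] {I : ModelWithCorners ℝ E H} {d c : ℕ}

theorem inner_leviCivita_eq_zero_of_leaf
    {M : Type*} [TopologicalSpace M] [ChartedSpace H M] [IsManifold I ∞ M] [T2Space M]
    [BoundarylessManifold I M] [RiemannianBundle (fun x : M ↦ TangentSpace I x)]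
    [IsContMDiffRiemannianBundle I ∞ E (fun x : M ↦ TangentSpace I x)]
    (G : Foliation I M c d) {X : Π x : M, TangentSpace I x} {x : M} (hX : MDiffAt (T% X) x)
    (h0 : ∀ y ∈ G.leaf x, X y = 0) {v : TangentSpace I x} (hv : v ∈ G.tangent x) :
    inner ℝ v (leviCivita I M X x v) = 0 := by
  have : CompleteSpace E := FiniteDimensional.complete ℝ E
  have hN := G.contMDiffAt_tangentExtend v
  obtain ⟨γ, hγ0, hγ⟩ := exists_isMIntegralCurveAt_of_contMDiffAt_boundaryless (I := I) 0
    (hN.of_le (by simp))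
  obtain ⟨ε, hε, hγ'⟩ := isMIntegralCurveAt_iff'.1 hγ
  rw [Real.ball_eq_Ioo] at hγ'
  have hmem : Ioo (0 - ε) (0 + ε) ∈ 𝓝 (0 : ℝ) := Ioo_mem_nhds (by linarith) (by linarith)
  have hz : pairing (G.tangentExtend v) X ∘ γ =ᶠ[𝓝 0] fun _ ↦ 0 := by
    filter_upwards [hmem] with t ht
    have := mem_leaf_of_isMIntegralCurveOn hγ' (G.tangentExtend_mem v) (mem_of_mem_nhds hmem) ht
    rw [hγ0] at this
    simp [pairing, h0 _ this]
  subst hγ0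
  have hNd := hN.mdifferentiableAt (by simp)
  have hd := hγ.hasMFDerivAt.hasDerivAt_comp (mdifferentiableAt_pairing hNd hX)
  have hd0 := hd.unique ((hasDerivAt_const (0 : ℝ) (0 : ℝ)).congr_of_eventuallyEq hz)
  rw [G.tangentExtend_self hv, mvfderiv_pairing hNd hX, h0 _ Relation.ReflTransGen.refl,
    inner_zero_right, zero_add, G.tangentExtend_self hv] at hd0
  exact hd0

variable {M : Type*} [EMetricSpace M] [CompleteSpace M] [ChartedSpace H M] [IsManifold I ∞ M]
  [BoundarylessManifold I M] [RiemannianBundle (fun x : M ↦ TangentSpace I x)]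
  [IsContMDiffRiemannianBundle I ∞ E (fun x : M ↦ TangentSpace I x)] [IsRiemannianManifold I M]

/-- A field tangent to the leaves, growing quadratically along its own direction on a leaf of a
complete manifold, vanishes on that leaf. -/
theorem eq_zero_of_norm_pow_four_le (G : Foliation I M c d) {X : Π x : M, TangentSpace I x}
    (hX : CMDiff ∞ (T% X)) (hXG : ∀ x, X x ∈ G.tangent x) {x₀ : M}
    (h : ∀ x ∈ G.leaf x₀, ‖X x‖ ^ 4 ≤ inner ℝ (X x) (leviCivita I M X x (X x))) :
    X x₀ = 0 := by
  have : CompleteSpace E := FiniteDimensional.complete ℝ E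
  by_contra hne
  have hq (x : M) : pairing X X x = ‖X x‖ ^ 2 := real_inner_self_eq_norm_sq _
  set r : M → ℝ := fun x ↦ √(1 + pairing X X x) with hr
  have hpos (x : M) : 0 < 1 + pairing X X x := by rw [hq]; positivity
  have hr2 (x : M) : r x ^ 2 = 1 + ‖X x‖ ^ 2 := by rw [hr, Real.sq_sqrt (hpos x).le, hq]
  have hr0 (x : M) : 0 < r x := Real.sqrt_pos.2 (hpos x)
  have hXr (x : M) : ‖X x‖ ≤ r x := by
    refine Real.le_sqrt_of_sq_le ?_
    rw [hq]
    linarith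
  have hr1 (x : M) : 1 ≤ r x := by nlinarith [hr2 x, hr0 x, sq_nonneg ‖X x‖]
  set W : Π x : M, TangentSpace I x := fun x ↦ (r x)⁻¹ • X x with hW
  have hWs : CMDiff ∞ (T% W) := by
    intro x
    refine ContMDiffAt.smul_section ?_ (hX x)
    have h1 : CMDiffAt ∞ (fun x ↦ 1 + pairing X X x) x :=
      contMDiffAt_const.add (contMDiffAt_pairing (hX x) (hX x))
    have h2 : ContDiffAt ℝ ∞ (fun s ↦ (√s)⁻¹) (1 + pairing X X x) :=
      (Real.contDiffAt_sqrt (hpos x).ne').inv (hr0 x).ne'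
    exact ContMDiffAt.comp (g := fun s : ℝ ↦ (√s)⁻¹) (f := fun x ↦ 1 + pairing X X x) x
      h2.contMDiffAt h1
  have hW1 (x : M) : ‖W x‖ ≤ 1 := by
    rw [hW, norm_smul, norm_inv, Real.norm_of_nonneg (hr0 x).le, inv_mul_le_one₀ (hr0 x)]
    exact hXr x
  obtain ⟨δ, hδ, hγ⟩ := exists_isMIntegralCurveOn_Ioo_of_norm_le
    (hWs.of_le (by simp)) hW1 x₀
  have hz0 : 0 < r x₀ - 1 := by
    have := norm_pos_iff.2 hne
    nlinarith [hr2 x₀, hr1 x₀]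
  obtain ⟨γ, hγ0, hγ⟩ := hγ (2 / (r x₀ - 1) + 1)
  have hT : 0 < 2 / (r x₀ - 1) := by positivity
  have hd (t : ℝ) (ht : t ∈ Icc 0 (2 / (r x₀ - 1))) : HasDerivAt (fun t ↦ r (γ t) - 1)
      (inner ℝ (X (γ t)) (leviCivita I M X (γ t) (X (γ t))) / r (γ t) ^ 2) t := by
    have hXd := (hX (γ t)).mdifferentiableAt (by simp)
    have h1 := (hγ.isMIntegralCurveAt (t₀ := t) (Ioo_mem_nhds (by linarith [ht.1])
      (by linarith [ht.2]))).hasMFDerivAt.hasDerivAt_comp (mdifferentiableAt_pairing hXd hXd)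
    rw [mvfderiv_pairing hXd hXd, hW] at h1
    simp only [map_smul, real_inner_smul_left, real_inner_smul_right] at h1
    refine (((h1.const_add 1).sqrt (hpos (γ t)).ne').sub_const 1).congr_deriv ?_
    change _ / (2 * r (γ t)) = _
    rw [real_inner_comm (X (γ t))]
    have := (hr0 (γ t)).ne'
    field_simp
    ring
  have hle (t : ℝ) (ht : t ∈ Icc 0 (2 / (r x₀ - 1))) : (r (γ t) - 1) ^ 2
      ≤ inner ℝ (X (γ t)) (leviCivita I M X (γ t) (X (γ t))) / r (γ t) ^ 2 := by
    have hleaf : γ t ∈ G.leaf x₀ := hγ0 ▸ mem_leaf_of_isMIntegralCurveOn hγ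
      (fun x ↦ Submodule.smul_mem _ _ (hXG x)) ⟨by linarith, by linarith⟩
      ⟨by linarith [ht.1], by linarith [ht.2]⟩
    rw [le_div_iff₀ (pow_pos (hr0 _) 2)]
    refine le_trans ?_ (h _ hleaf)
    rw [show ‖X (γ t)‖ ^ 4 = ((r (γ t) - 1) * (r (γ t) + 1)) ^ 2 by
      rw [show (r (γ t) - 1) * (r (γ t) + 1) = r (γ t) ^ 2 - 1 by ring, hr2]; ring, ← mul_pow]
    have := hr1 (γ t)
    refine pow_le_pow_left₀ (mul_nonneg (by linarith) (by linarith)) ?_ 2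
    exact mul_le_mul_of_nonneg_left (by linarith) (by linarith)
  have := mul_le_one_of_sq_le_deriv hT.le (by rwa [hγ0]) hd hle
  rw [hγ0, div_mul_cancel₀ _ hz0.ne'] at this
  norm_num at this

theorem meanCurvature_eq_zero_of_divergence_le {F : Foliation I M d c} {G : Foliation I M c d}
    (hFG : F.IsOrthogonal G) (hU : G.IsTotallyUmbilical) (hc : 0 < c) {x₀ : M}
    (hdiv : ∀ x ∈ G.leaf x₀, ∀ v ∈ G.tangent x, ‖v‖ = 1 →
      F.divergence G.meanCurvature x ≤ F.curvatureTrace x v) :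
    F.meanCurvature x₀ = 0 := by
  rcases Nat.eq_zero_or_pos d with rfl | hd
  · simp [meanCurvature]
  have hd' : (0 : ℝ) < d := by exact_mod_cast hd
  have hmem (x : M) : F.meanCurvature x ∈ G.tangent x := hFG x ▸ F.meanCurvature_mem x
  refine G.eq_zero_of_norm_pow_four_le F.contMDiffAt_meanCurvature hmem fun x hx ↦ ?_
  set X := F.meanCurvature x with hX
  rcases eq_or_ne X 0 with h0 | h0
  · simp [h0]
  have hn : 0 < ‖X‖ := norm_pos_iff.2 h0
  have hv1 : ‖‖X‖⁻¹ • X‖ = 1 := norm_smul_inv_norm h0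
  have hv : ‖X‖⁻¹ • X ∈ G.tangent x := Submodule.smul_mem _ _ (hmem x)
  have h1 := le_inner_leviCivita_meanCurvature hFG hU hc hv hv1
  have h2 := hdiv x hx _ hv hv1
  have h3 : (d : ℝ) * inner ℝ (‖X‖⁻¹ • X) X ^ 2
      ≤ d * inner ℝ (‖X‖⁻¹ • X) (leviCivita I M F.meanCurvature x (‖X‖⁻¹ • X)) := by
    nlinarith [sq_nonneg ‖G.meanCurvature x‖]
  have h4 := le_of_mul_le_mul_left h3 hd'
  simp only [map_smul, real_inner_smul_left, real_inner_smul_right,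
    real_inner_self_eq_norm_sq] at h4
  field_simp at h4
  calc ‖X‖ ^ 4 = ‖X‖ ^ 2 * ‖X‖ ^ 2 := by ring
    _ ≤ _ := by linarith

end Foliation

end

theorem lemma1 {n p : ℕ} {M : Type*} [EMetricSpace M]
    [ChartedSpace (EuclideanSpace ℝ (Fin (n + p))) M] [IsManifold (𝓡 (n + p)) ∞ M]
    [RiemannianBundle (fun x : M ↦ TangentSpace (𝓡 (n + p)) x)]
    [IsContMDiffRiemannianBundle (𝓡 (n + p)) ∞ (EuclideanSpace ℝ (Fin (n + p)))
      (fun x : M ↦ TangentSpace (𝓡 (n + p)) x)]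
    [IsRiemannianManifold (𝓡 (n + p)) M] [CompleteSpace M]
    (F : Foliation (𝓡 (n + p)) M n p) (G : Foliation (𝓡 (n + p)) M p n)
    (orthogonal : F.IsOrthogonal G)
    (umbilical : (2 ≤ p ∧ G.IsTotallyUmbilical) ∨ p = 1)
    (bounded : ∃ C : ℝ, ∀ x, ‖G.meanCurvature x‖ ≤ C)
    (L : Set M) (isLeaf : G.IsLeaf L)
    (isMax : ∃ x₀ ∈ L, ∀ x, ‖G.meanCurvature x‖ ≤ ‖G.meanCurvature x₀‖)
    (trace_nonneg : ∀ x, ∀ v ∈ G.tangent x, ‖v‖ = 1 → 0 ≤ F.curvatureTrace x v)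
    (div_le_trace : ∀ x ∈ L, ∀ v ∈ G.tangent x, ‖v‖ = 1 →
      F.divergence G.meanCurvature x ≤ F.curvatureTrace x v) :
    (∀ x ∈ L, F.meanCurvature x = 0) ∧
    (∀ x, G.meanCurvature x = 0) ∧
    (∀ x, ∀ v ∈ G.tangent x, ‖v‖ = 1 → F.curvatureTrace x v = 0) ∧
    (∀ x, F.meanCurvature x = 0) := by
  have hp : 0 < p := by rcases umbilical with h | h <;> omega
  have hU : G.IsTotallyUmbilical := by
    rcases umbilical with h | rfl
    · exact h.2
    · exact G.isTotallyUmbilical_of_dim_one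
  obtain ⟨x₁, rfl⟩ := isLeaf
  have hsub {x : M} (hx : x ∈ G.leaf x₁) : G.leaf x ⊆ G.leaf x₁ := fun y hy ↦
    Relation.ReflTransGen.trans hx hy
  have hL : ∀ x ∈ G.leaf x₁, F.meanCurvature x = 0 := fun x hx ↦
    Foliation.meanCurvature_eq_zero_of_divergence_le orthogonal hU hp fun y hy ↦
      div_le_trace y (hsub hx hy)
  have hG : ∀ x, G.meanCurvature x = 0 := by
    obtain ⟨x₀, hx₀, hmax⟩ := isMax
    suffices h : G.meanCurvature x₀ = 0 by
      intro x
      simpa [h] using hmax x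
    have : Nontrivial (G.tangent x₀) :=
      Module.nontrivial_of_finrank_pos (R := ℝ) (by rwa [G.finrank_tangent])
    obtain ⟨⟨v, hv⟩, hv1⟩ := exists_norm_eq (G.tangent x₀) zero_le_one
    have h1 := Foliation.le_inner_leviCivita_meanCurvature orthogonal hU hp hv hv1
    rw [G.inner_leviCivita_eq_zero_of_leaf
      ((F.contMDiffAt_meanCurvature x₀).mdifferentiableAt (by simp))
      (fun y hy ↦ hL y (hsub hx₀ hy)) hv, hL x₀ hx₀, inner_zero_right] at h1
    have h2 := div_le_trace x₀ hx₀ v hv hv1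
    have h3 : ‖G.meanCurvature x₀‖ ^ 2 ≤ 0 := by linarith
    simpa using h3
  have hdiv (x : M) : F.divergence G.meanCurvature x = 0 := by
    rw [show G.meanCurvature = 0 from funext hG]
    simp [Foliation.divergence]
  have hF (x : M) : F.meanCurvature x = 0 :=
    Foliation.meanCurvature_eq_zero_of_divergence_le orthogonal hU hp fun y _ v hv hv1 ↦
      (hdiv y).trans_le (trace_nonneg y v hv hv1)
  refine ⟨hL, hG, fun x v hv hv1 ↦ le_antisymm ?_ (trace_nonneg x v hv hv1), hF⟩
  have h1 := Foliation.le_inner_leviCivita_meanCurvature orthogonal hU hp hv hv1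
  rw [G.inner_leviCivita_eq_zero_of_leaf
    ((F.contMDiffAt_meanCurvature x).mdifferentiableAt (by simp)) (fun y _ ↦ hF y) hv,
    hdiv, hF, hG] at h1
  simpa using h1
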